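/- Let $\mathbb{D}$ be the open unit disc in $\mathbb{C}$ and let $H^2$ be the Hardy space of all holomorphic $f:\mathbb{D}\to\mathbb{C}$ with $$\|f\|_2=\sup_{0\le r<1}\Big(\frac1{2\pi}\int_0^{2\pi}|f(re^{it})|^2\,dt\Big)^{1/2}<\infty .$$ Let $\varphi:\mathbb{D}\to\mathbb{D}$ be holomorphic, let $C_\varphi f=f\circ\varphi$ be the (bounded) composition operator on $H^2$, and let $(M_zf)(z)=zf(z)$. For a bounded linear operator $T$ write $\mathrm{Lat}\,T$ for the set of all closed subspaces invariant under $T$. Then there is a nonzero closed subspace $\mathcal{S}\subsetneq H^2$ with $$\mathcal{S}\in \mathrm{Lat}\,C_\varphi\cap\mathrm{Lat}\,M_z .$$ More precisely: (i) if $\alpha\in\mathbb{D}$ and $\varphi(\alpha)=\alpha$, then $\mathcal{S}=\theta H^2$ has these properties, where $\theta(z)=\dfrac{\alpha-z}{1-\overline{\alpha}z}$; (ii) if $\varphi$ has no fixed point in $\mathbb{D}$, then $\varphi$ has a Denjoy–Wolff point $a$ with $|a|=1$ (that is, the iterates $\varphi^{n}=\varphi\circ\cdots\circ\varphi$ converge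 to the constant $a$ uniformly on compact subsets of $\mathbb{D}$), and for every $t>0$ the space $\mathcal{S}=\theta_tH^2$ has these properties, where $\theta_t(z)=\exp\!\Big(t\,\dfrac{z+a}{z-a}\Big)$. -/

import Mathlib

open Metric Set Filter Topology

noncomputable section

namespace Hardy

/-! ### The Hardy space `H²` of the open unit disc `𝔻 = ball 0 1` -/

/-- The `L²` mean `((1 / 2π) ∫₀^{2π} |f (r e^{it})|² dt)^{1/2}` of `f` on the circle of radius `r`. -/
def mean (f : ℂ → ℂ) (r : ℝ) : ℝ :=
  Real.sqrt (Real.circleAverage (fun z => ‖f z‖ ^ 2) 0 r)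

/-- Membership in `H²`: `f` is holomorphic on the open unit disc and its `L²` means on the circles
of radius `r`, `0 ≤ r < 1`, are bounded. A function on the disc is represented by its extension by
zero to `ℂ`, so that elements of `H²` are equal if and only if they agree on the disc. -/
structure IsHardy (f : ℂ → ℂ) : Prop where
  holo : DifferentiableOn ℂ f (ball 0 1)
  zero_off : ∀ z, z ∉ ball (0 : ℂ) 1 → f z = 0
  bdd : BddAbove (mean f '' Ico (0 : ℝ) 1)

theorem mean_nonneg (f : ℂ → ℂ) (r : ℝ) : 0 ≤ mean f r := Real.sqrt_nonneg _

theorem avg_nonneg (f : ℂ → ℂ) (r : ℝ) : 0 ≤ Real.circleAverage (fun z => ‖f z‖ ^ 2) 0 r :=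
  Real.circleAverage_nonneg_of_nonneg fun _ _ => by positivity

theorem mean_le_iff (f : ℂ → ℂ) (r : ℝ) {a : ℝ} (ha : 0 ≤ a) :
    mean f r ≤ a ↔ Real.circleAverage (fun z => ‖f z‖ ^ 2) 0 r ≤ a ^ 2 :=
  Real.sqrt_le_left ha

theorem sphere_subset {r : ℝ} (hr : r ∈ Ico (0 : ℝ) 1) : sphere (0 : ℂ) |r| ⊆ ball 0 1 := by
  intro z hz
  simp only [mem_sphere, mem_ball, dist_zero_right] at *
  rw [hz, abs_of_nonneg hr.1]
  exact hr.2

theorem circleIntegrable {f : ℂ → ℂ} (hf : DifferentiableOn ℂ f (ball 0 1)) {r : ℝ}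
    (hr : r ∈ Ico (0 : ℝ) 1) : CircleIntegrable (fun z => ‖f z‖ ^ 2) 0 r := by
  apply ContinuousOn.circleIntegrable'
  exact ((hf.continuousOn.mono (sphere_subset hr)).norm.pow 2)

theorem mean_add_le {f g : ℂ → ℂ} (hf : DifferentiableOn ℂ f (ball 0 1))
    (hg : DifferentiableOn ℂ g (ball 0 1)) {r : ℝ} (hr : r ∈ Ico (0 : ℝ) 1) :
    mean (f + g) r ≤ mean f r + mean g r := by
  refine le_of_forall_pos_le_add fun ε hε => ?_
  set a := mean f r + ε / 2 with ha
  set b := mean g r + ε / 2 with hb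
  have ha0 : 0 < a := by have := mean_nonneg f r; positivity
  have hb0 : 0 < b := by have := mean_nonneg g r; positivity
  have hA := (mean_le_iff f r ha0.le).1 (by linarith)
  have hB := (mean_le_iff g r hb0.le).1 (by linarith)
  have hab : mean f r + mean g r + ε = a + b := by rw [ha, hb]; ring
  rw [hab, mean_le_iff _ _ (by positivity)]
  have if' := circleIntegrable hf hr
  have ig' := circleIntegrable hg hr
  have h1 : Real.circleAverage (fun z => ‖(f + g) z‖ ^ 2) 0 r ≤
      Real.circleAverage ((1 + b / a) • (fun z => ‖f z‖ ^ 2) + (1 + a / b) • (fun z => ‖g z‖ ^ 2))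
        0 r := by
    apply Real.circleAverage_mono (circleIntegrable (hf.add hg) hr)
    · exact (if'.const_smul).add (ig'.const_smul)
    · intro z _
      simp only [Pi.add_apply, Pi.smul_apply, smul_eq_mul]
      have h2 : ‖f z + g z‖ ^ 2 ≤ (‖f z‖ + ‖g z‖) ^ 2 := by
        gcongr
        exact norm_add_le _ _
      refine h2.trans ?_
      have h3 : (1 + b / a) * ‖f z‖ ^ 2 + (1 + a / b) * ‖g z‖ ^ 2 - (‖f z‖ + ‖g z‖) ^ 2
          = (b * ‖f z‖ - a * ‖g z‖) ^ 2 / (a * b) := by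
        field_simp
        ring
      have h4 : 0 ≤ (b * ‖f z‖ - a * ‖g z‖) ^ 2 / (a * b) := by positivity
      linarith
  refine h1.trans ?_
  rw [Real.circleAverage_add if'.const_smul ig'.const_smul, Real.circleAverage_smul,
    Real.circleAverage_smul, smul_eq_mul, smul_eq_mul]
  calc _ ≤ (1 + b / a) * a ^ 2 + (1 + a / b) * b ^ 2 := by gcongr
    _ = (a + b) ^ 2 := by field_simp; ring

theorem mean_smul (c : ℂ) (f : ℂ → ℂ) (r : ℝ) : mean (c • f) r = ‖c‖ * mean f r := by
  have : (fun z => ‖(c • f) z‖ ^ 2) = (‖c‖ ^ 2) • (fun z => ‖f z‖ ^ 2) := by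
    ext z
    simp [mul_pow]
  rw [mean, this, Real.circleAverage_smul, smul_eq_mul, Real.sqrt_mul (by positivity),
    Real.sqrt_sq (norm_nonneg c), mean]

theorem mean_zero (r : ℝ) : mean 0 r = 0 := by
  have := mean_smul 0 0 r
  simpa using this

/-- `H²` as a linear space of functions. -/
def hardySubmodule : Submodule ℂ (ℂ → ℂ) where
  carrier := {f | IsHardy f}
  zero_mem' := ⟨differentiableOn_const 0, fun _ _ => rfl, 0, by
    rintro _ ⟨r, _, rfl⟩
    exact (mean_zero r).le⟩
  add_mem' := by
    rintro f g hf hg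
    refine ⟨hf.holo.add hg.holo, fun z hz => ?_, ?_⟩
    · simp [hf.zero_off z hz, hg.zero_off z hz]
    · obtain ⟨A, hA⟩ := hf.bdd
      obtain ⟨B, hB⟩ := hg.bdd
      refine ⟨A + B, ?_⟩
      rintro _ ⟨r, hr, rfl⟩
      exact (mean_add_le hf.holo hg.holo hr).trans
        (add_le_add (hA ⟨r, hr, rfl⟩) (hB ⟨r, hr, rfl⟩))
  smul_mem' := by
    rintro c f hf
    refine ⟨hf.holo.const_smul c, fun z hz => ?_, ?_⟩
    · simp [hf.zero_off z hz]
    · obtain ⟨A, hA⟩ := hf.bdd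
      refine ⟨‖c‖ * A, ?_⟩
      rintro _ ⟨r, hr, rfl⟩
      rw [mean_smul]
      exact mul_le_mul_of_nonneg_left (hA ⟨r, hr, rfl⟩) (norm_nonneg c)

/-- The Hardy space `H²`. (A type of its own, so that it carries the topology of its norm and not
the topology of pointwise convergence.) -/
def H2 : Type := hardySubmodule

instance : AddCommGroup H2 := inferInstanceAs (AddCommGroup hardySubmodule)

instance : Module ℂ H2 := inferInstanceAs (Module ℂ hardySubmodule)

/-- The underlying function of an element of `H²`. -/
def H2.fn (f : H2) : ℂ → ℂ := Subtype.val f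

instance : CoeFun H2 (fun _ => ℂ → ℂ) := ⟨H2.fn⟩

/-- The element of `H²` given by a function. -/
def H2.mk (f : ℂ → ℂ) (hf : IsHardy f) : H2 := Subtype.mk f hf

theorem H2.isHardy (f : H2) : IsHardy f := Subtype.property f

@[simp] theorem H2.mk_fn (f : ℂ → ℂ) (hf : IsHardy f) : H2.fn (H2.mk f hf) = f := rfl

@[simp] theorem H2.add_fn (f g : H2) : H2.fn (f + g) = H2.fn f + H2.fn g := rfl

@[simp] theorem H2.smul_fn (c : ℂ) (f : H2) : H2.fn (c • f) = c • H2.fn f := rfl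

@[simp] theorem H2.zero_fn : H2.fn 0 = 0 := rfl

theorem H2.ext_fn {f g : H2} (h : ∀ z ∈ ball (0 : ℂ) 1, f z = g z) : f = g := by
  apply Subtype.ext
  funext z
  by_cases hz : z ∈ ball (0 : ℂ) 1
  · exact h z hz
  · exact (f.isHardy.zero_off z hz).trans (g.isHardy.zero_off z hz).symm

/-- The norm of `H²`: the supremum of the `L²` means over the circles of radius `r`, `0 ≤ r < 1`. -/
instance : Norm H2 := ⟨fun f => sSup (mean f '' Ico (0 : ℝ) 1)⟩

theorem H2.norm_def (f : H2) : ‖f‖ = sSup (mean f '' Ico (0 : ℝ) 1) := rfl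

theorem H2.mean_le_norm (f : H2) {r : ℝ} (hr : r ∈ Ico (0 : ℝ) 1) : mean f r ≤ ‖f‖ :=
  le_csSup f.isHardy.bdd ⟨r, hr, rfl⟩

theorem H2.norm_le_of (f : H2) {a : ℝ} (h : ∀ r ∈ Ico (0 : ℝ) 1, mean f r ≤ a) : ‖f‖ ≤ a := by
  apply csSup_le (Set.Nonempty.image _ ⟨0, by simp⟩)
  rintro _ ⟨r, hr, rfl⟩
  exact h r hr

theorem H2.norm_nonneg' (f : H2) : 0 ≤ ‖f‖ :=
  (mean_nonneg f 0).trans (f.mean_le_norm (by simp))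

/-- The least harmonic majorant bound: `|f|²` lies below the Poisson integral of its values on a
circle, written as the real part of a holomorphic function. -/
theorem sq_le_herglotz {f : ℂ → ℂ} (hf : DifferentiableOn ℂ f (ball 0 1)) {R : ℝ}
    (hR0 : 0 < R) (hR1 : R < 1) {w : ℂ} (hw : w ∈ ball (0 : ℂ) R) :
    ‖f w‖ ^ 2 ≤ (Real.circleAverage
      (fun ζ => herglotzRieszKernel 0 w ζ • ((‖f ζ‖ ^ 2 : ℝ) : ℂ)) 0 R).re := by
  have hR : R ∈ Ico (0 : ℝ) 1 := ⟨hR0.le, hR1⟩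
  have hd : DiffContOnCl ℂ (fun z => f z ^ 2) (ball 0 R) := by
    apply DifferentiableOn.diffContOnCl
    rw [closure_ball 0 hR0.ne']
    exact (hf.mono (closedBall_subset_ball hR1)).pow 2
  have h1 := hd.circleAverage_re_herglotzRieszKernel_smul hw
  rw [re_circleAverage_herglotzRieszKernel_smul (circleIntegrable hf hR) hw, ← norm_pow, ← h1,
    Real.circleAverage_def, Real.circleAverage_def, norm_smul, Real.norm_of_nonneg (by positivity),
    smul_eq_mul]
  gcongr
  refine (intervalIntegral.norm_integral_le_integral_norm (by positivity)).trans_eq ?_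
  apply intervalIntegral.integral_congr
  intro θ _
  have hz : circleMap 0 R θ ∈ sphere (0 : ℂ) R := circleMap_mem_sphere 0 hR0.le θ
  have hpos : 0 ≤ (herglotzRieszKernel 0 w (circleMap 0 R θ)).re := by
    refine le_trans ?_ (le_re_herglotzRieszKernel hz hw)
    rw [sub_zero]
    have : ‖w‖ < R := by simpa using hw
    apply div_nonneg
    · linarith
    · positivity
  simp only [Pi.smul_apply', Function.comp_apply, norm_smul, norm_pow, smul_eq_mul]
  rw [Real.norm_of_nonneg hpos]

theorem herglotz_le {f : ℂ → ℂ} (hf : DifferentiableOn ℂ f (ball 0 1)) {R : ℝ}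
    (hR0 : 0 < R) (hR1 : R < 1) {w : ℂ} (hw : w ∈ ball (0 : ℂ) R) :
    (Real.circleAverage
      (fun ζ => herglotzRieszKernel 0 w ζ • ((‖f ζ‖ ^ 2 : ℝ) : ℂ)) 0 R).re ≤
      (R + ‖w‖) / (R - ‖w‖) * mean f R ^ 2 := by
  have hR : R ∈ Ico (0 : ℝ) 1 := ⟨hR0.le, hR1⟩
  have hi := circleIntegrable hf hR
  have hm : mean f R ^ 2 = Real.circleAverage (fun z => ‖f z‖ ^ 2) 0 R :=
    Real.sq_sqrt (avg_nonneg f R)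
  rw [re_circleAverage_herglotzRieszKernel_smul hi hw, hm, ← smul_eq_mul,
    ← Real.circleAverage_smul]
  apply Real.circleAverage_mono
  · apply ContinuousOn.circleIntegrable'
    refine ContinuousOn.smul ?_ ((hf.continuousOn.mono (sphere_subset hR)).norm.pow 2)
    exact Complex.continuous_re.comp_continuousOn (continuousOn_herglotzRieszKernel_sphere hw)
  · exact hi.const_smul
  · intro z hz
    rw [abs_of_pos hR0] at hz
    have := re_herglotzRieszKernel_le hz hw
    simp only [Pi.smul_apply', Function.comp_apply, Pi.smul_apply, smul_eq_mul,
      herglotzRieszKernel_def]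
    rw [sub_zero] at this
    apply mul_le_mul_of_nonneg_right _ (by positivity)
    simpa using this

theorem normCore : NormedSpace.Core ℂ H2 where
  norm_nonneg := H2.norm_nonneg'
  norm_smul c f := by
    apply le_antisymm
    · apply H2.norm_le_of
      intro r hr
      rw [H2.smul_fn, mean_smul]
      exact mul_le_mul_of_nonneg_left (f.mean_le_norm hr) (norm_nonneg c)
    · rcases eq_or_ne c 0 with rfl | hc
      · rw [norm_zero, zero_mul]
        exact H2.norm_nonneg' _
      · have hc' : 0 < ‖c‖ := norm_pos_iff.2 hc
        rw [← le_div_iff₀' hc']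
        apply H2.norm_le_of
        intro r hr
        rw [le_div_iff₀' hc', ← mean_smul, ← H2.smul_fn]
        exact (c • f).mean_le_norm hr
  norm_triangle f g := by
    apply H2.norm_le_of
    intro r hr
    exact (mean_add_le f.isHardy.holo g.isHardy.holo hr).trans
      (add_le_add (f.mean_le_norm hr) (g.mean_le_norm hr))
  norm_eq_zero_iff f := by
    constructor
    · intro h
      apply H2.ext_fn
      intro w hw
      have hw' : ‖w‖ < 1 := by simpa using hw
      obtain ⟨R, hR, hR1⟩ := exists_between hw'
      have hR0 : 0 < R := (norm_nonneg w).trans_lt hR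
      have hwR : w ∈ ball (0 : ℂ) R := by simpa using hR
      have h1 := (sq_le_herglotz f.isHardy.holo hR0 hR1 hwR).trans
        (herglotz_le f.isHardy.holo hR0 hR1 hwR)
      have h2 : mean f R = 0 :=
        le_antisymm (h ▸ f.mean_le_norm ⟨hR0.le, hR1⟩) (mean_nonneg _ _)
      rw [h2] at h1
      have h3 : ‖f w‖ ^ 2 = 0 := le_antisymm (by simpa using h1) (by positivity)
      simpa using h3
    · rintro rfl
      refine le_antisymm (H2.norm_le_of _ fun r _ => ?_) (H2.norm_nonneg' _)
      rw [H2.zero_fn, mean_zero]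

instance : NormedAddCommGroup H2 := NormedAddCommGroup.ofCore normCore

instance : NormedSpace ℂ H2 := NormedSpace.ofCore normCore

/-! ### The operators `M_z` and `C_φ` -/

theorem isHardy_shift (f : H2) : IsHardy (fun z => z * f z) ∧
    ∀ r ∈ Ico (0 : ℝ) 1, mean (fun z => z * f z) r ≤ ‖f‖ := by
  have hd : DifferentiableOn ℂ (fun z => z * f z) (ball 0 1) :=
    differentiableOn_id.mul f.isHardy.holo
  have hb : ∀ r ∈ Ico (0 : ℝ) 1, mean (fun z => z * f z) r ≤ ‖f‖ := by
    intro r hr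
    refine le_trans ?_ (f.mean_le_norm hr)
    apply Real.sqrt_le_sqrt
    apply Real.circleAverage_mono (circleIntegrable hd hr) (circleIntegrable f.isHardy.holo hr)
    intro z hz
    have hz1 : ‖z‖ ≤ 1 := by simpa using (ball_subset_closedBall (sphere_subset hr hz))
    rw [norm_mul, mul_pow]
    exact mul_le_of_le_one_left (by positivity) (pow_le_one₀ (norm_nonneg z) hz1)
  refine ⟨⟨hd, fun z hz => ?_, ‖f‖, ?_⟩, hb⟩
  · simp [f.isHardy.zero_off z hz]
  · rintro _ ⟨r, hr, rfl⟩
    exact hb r hr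

/-- The shift `M_z` on `H²`: multiplication by the coordinate function. -/
def shiftOp : H2 →L[ℂ] H2 :=
  LinearMap.mkContinuous
    { toFun := fun f => H2.mk (fun z => z * f z) (isHardy_shift f).1
      map_add' := fun f g => H2.ext_fn fun z _ => by simp [mul_add]
      map_smul' := fun c f => H2.ext_fn fun z _ => by simp [mul_left_comm] }
    1 (fun f => by
      rw [one_mul]
      exact H2.norm_le_of _ (isHardy_shift f).2)

theorem shiftOp_apply (f : H2) (z : ℂ) : shiftOp f z = z * f z := rfl

/-- `φ` is a holomorphic self-map of the open unit disc. (Values off the disc are irrelevant.) -/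
structure IsHolSelfMap (φ : ℂ → ℂ) : Prop where
  holo : DifferentiableOn ℂ φ (ball 0 1)
  mapsTo : MapsTo φ (ball 0 1) (ball 0 1)

theorem mean_comp_le {φ : ℂ → ℂ} (hφ : IsHolSelfMap φ) (f : H2) {r : ℝ}
    (hr : r ∈ Ico (0 : ℝ) 1) :
    mean (fun z => f (φ z)) r ≤ Real.sqrt (4 / (1 - ‖φ 0‖)) * ‖f‖ := by
  have h0 : ‖φ 0‖ < 1 := by simpa using hφ.mapsTo (mem_ball_self one_pos)
  have hsub : closedBall (0 : ℂ) r ⊆ ball 0 1 := closedBall_subset_ball hr.2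
  -- the image of the closed disc of radius `r` stays in a smaller disc
  obtain ⟨z₀, hz₀, hmax⟩ := (isCompact_closedBall (0 : ℂ) r).exists_isMaxOn
    ⟨0, by simpa using hr.1⟩ (hφ.holo.continuousOn.mono hsub).norm
  have hz₁ : ‖φ z₀‖ < 1 := by simpa using hφ.mapsTo (hsub hz₀)
  obtain ⟨R, hR, hR1⟩ := exists_between (max_lt hz₁ (by linarith : (1 + ‖φ 0‖) / 2 < 1))
  have hRa : (1 + ‖φ 0‖) / 2 < R := (le_max_right _ _).trans_lt hR
  have hRb : ‖φ z₀‖ < R := (le_max_left _ _).trans_lt hR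
  have hn0 : 0 ≤ ‖φ 0‖ := norm_nonneg _
  have hR0 : 0 < R := by linarith
  have hRI : R ∈ Ico (0 : ℝ) 1 := ⟨hR0.le, hR1⟩
  have hmaps : MapsTo φ (closedBall 0 r) (ball 0 R) := fun z hz => by
    have : ‖φ z‖ ≤ ‖φ z₀‖ := hmax hz
    simpa using this.trans_lt hRb
  have h00 : (0 : ℂ) ∈ closedBall (0 : ℂ) r := by simpa using hr.1
  set H : ℂ → ℂ := fun w => Real.circleAverage
      (fun ζ => herglotzRieszKernel 0 w ζ • ((‖f ζ‖ ^ 2 : ℝ) : ℂ)) 0 R with hH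
  have hci : CircleIntegrable (fun ζ => ((‖f ζ‖ ^ 2 : ℝ) : ℂ)) 0 R := by
    apply ContinuousOn.circleIntegrable'
    exact Complex.continuous_ofReal.comp_continuousOn
      ((f.isHardy.holo.continuousOn.mono (sphere_subset hRI)).norm.pow 2)
  have hHd : DifferentiableOn ℂ H (ball 0 R) :=
    differentiableOn_circleAverage_herglotzRieszKernel_smul hci
  have hcompd : DifferentiableOn ℂ (fun z => H (φ z)) (closedBall 0 r) :=
    hHd.comp (hφ.holo.mono hsub) hmaps
  have hcl : closure (ball (0 : ℂ) |r|) ⊆ closedBall 0 r := by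
    rw [abs_of_nonneg hr.1]
    exact closure_ball_subset_closedBall
  have hmv : Real.circleAverage (fun z => H (φ z)) 0 r = H (φ 0) :=
    (hcompd.mono hcl).diffContOnCl.circleAverage
  have hsph : sphere (0 : ℂ) |r| ⊆ closedBall 0 r := by
    rw [abs_of_nonneg hr.1]
    exact sphere_subset_closedBall
  have hint : CircleIntegrable (fun z => H (φ z)) 0 r :=
    (hcompd.continuousOn.mono hsph).circleIntegrable'
  have hre : Real.circleAverage (fun z => (H (φ z)).re) 0 r = (H (φ 0)).re := by
    have := Complex.reCLM.circleAverage_comp_comm hint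
    rw [hmv] at this
    exact this
  rw [mean_le_iff _ _ (mul_nonneg (Real.sqrt_nonneg _) (H2.norm_nonneg' f)), mul_pow,
    Real.sq_sqrt (div_nonneg (by norm_num) (by linarith))]
  calc Real.circleAverage (fun z => ‖f (φ z)‖ ^ 2) 0 r
      ≤ Real.circleAverage (fun z => (H (φ z)).re) 0 r := by
        apply Real.circleAverage_mono
        · exact circleIntegrable (f.isHardy.holo.comp hφ.holo hφ.mapsTo) hr
        · apply ContinuousOn.circleIntegrable'
          exact Complex.continuous_re.comp_continuousOn (hcompd.continuousOn.mono hsph)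
        · intro z hz
          exact sq_le_herglotz f.isHardy.holo hR0 hR1 (hmaps (hsph hz))
    _ = (H (φ 0)).re := hre
    _ ≤ (R + ‖φ 0‖) / (R - ‖φ 0‖) * mean f R ^ 2 :=
        herglotz_le f.isHardy.holo hR0 hR1 (hmaps h00)
    _ ≤ 4 / (1 - ‖φ 0‖) * ‖f‖ ^ 2 := by
        have h1 := f.mean_le_norm hRI
        have h2 := mean_nonneg f R
        have h3 : (R + ‖φ 0‖) / (R - ‖φ 0‖) ≤ 4 / (1 - ‖φ 0‖) := by
          rw [div_le_div_iff₀ (by linarith) (by linarith)]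
          nlinarith
        have h4 : 0 ≤ 4 / (1 - ‖φ 0‖) := div_nonneg (by norm_num) (by linarith)
        gcongr

theorem mean_indicator (f : ℂ → ℂ) {r : ℝ} (hr : r ∈ Ico (0 : ℝ) 1) :
    mean ((ball (0 : ℂ) 1).indicator f) r = mean f r := by
  unfold mean
  congr 1
  apply Real.circleAverage_congr_sphere
  intro z hz
  simp [indicator_of_mem (sphere_subset hr hz)]

theorem isHardy_comp {φ : ℂ → ℂ} (hφ : IsHolSelfMap φ) (f : H2) :
    IsHardy ((ball (0 : ℂ) 1).indicator fun z => f (φ z)) := by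
  refine ⟨?_, fun z hz => indicator_of_notMem hz _, Real.sqrt (4 / (1 - ‖φ 0‖)) * ‖f‖, ?_⟩
  · exact (f.isHardy.holo.comp hφ.holo hφ.mapsTo).congr fun z hz => indicator_of_mem hz _
  · rintro _ ⟨r, hr, rfl⟩
    rw [mean_indicator _ hr]
    exact mean_comp_le hφ f hr

/-- The composition operator `C_φ` on `H²`: `(C_φ f)(z) = f (φ z)` for `z` in the disc. -/
def compOp (φ : ℂ → ℂ) (hφ : IsHolSelfMap φ) : H2 →L[ℂ] H2 :=
  LinearMap.mkContinuous
    { toFun := fun f => H2.mk ((ball (0 : ℂ) 1).indicator fun z => f (φ z)) (isHardy_comp hφ f)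
      map_add' := fun f g => H2.ext_fn fun z hz => by simp [indicator_of_mem hz]
      map_smul' := fun c f => H2.ext_fn fun z hz => by simp [indicator_of_mem hz] }
    (Real.sqrt (4 / (1 - ‖φ 0‖))) (fun f => by
      apply H2.norm_le_of
      intro r hr
      exact (mean_indicator _ hr).trans_le (mean_comp_le hφ f hr))

theorem compOp_apply {φ : ℂ → ℂ} (hφ : IsHolSelfMap φ) (f : H2) {z : ℂ}
    (hz : z ∈ ball (0 : ℂ) 1) : compOp φ hφ f z = f (φ z) :=
  indicator_of_mem hz fun z => f (φ z)

/-! ### Invariant subspaces -/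

/-- `Lat T`: the set of all closed subspaces that are invariant under `T`. -/
def Lat {E : Type*} [NormedAddCommGroup E] [NormedSpace ℂ E] (T : E →L[ℂ] E) :
    Set (Submodule ℂ E) :=
  {S | IsClosed (S : Set E) ∧ ∀ f ∈ S, T f ∈ S}

/-- The subspace `θ H² ∩ H²` of all `f ∈ H²` of the form `f = θ g` on the disc with `g ∈ H²`; it is
`θ H²` when `θ` is bounded and holomorphic on the disc. -/
def mulRange (θ : ℂ → ℂ) : Submodule ℂ H2 where
  carrier := {f | ∃ g : H2, ∀ z ∈ ball (0 : ℂ) 1, f z = θ z * g z}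
  zero_mem' := ⟨0, fun z _ => by simp⟩
  add_mem' := by
    rintro f₁ f₂ ⟨g₁, h₁⟩ ⟨g₂, h₂⟩
    exact ⟨g₁ + g₂, fun z hz => by simp [h₁ z hz, h₂ z hz, mul_add]⟩
  smul_mem' := by
    rintro c f ⟨g, h⟩
    exact ⟨c • g, fun z hz => by simp [h z hz, mul_left_comm]⟩

/-- The Blaschke factor `z ↦ (α - z) / (1 - ᾱ z)`. -/
def blaschkeFactor (α z : ℂ) : ℂ := (α - z) / (1 - (starRingEnd ℂ) α * z)

/-- The atomic singular inner function `z ↦ exp (t (z + a) / (z - a))`, `|a| = 1`, `t > 0`. -/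
def atomicInner (t : ℝ) (a z : ℂ) : ℂ := Complex.exp (t * ((z + a) / (z - a)))

/-- `a` is the Denjoy–Wolff point of `φ`: it lies in the closed disc and the iterates of `φ`
converge to the constant `a` uniformly on compact subsets of the open disc. -/
def IsDenjoyWolffPoint (φ : ℂ → ℂ) (a : ℂ) : Prop :=
  a ∈ closedBall (0 : ℂ) 1 ∧
    ∀ K ⊆ ball (0 : ℂ) 1, IsCompact K →
      TendstoUniformlyOn (fun n : ℕ => φ^[n]) (fun _ => a) atTop K

end Hardy

end

namespace Hardy

/-! ### The Schwarz–Pick lemma -/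

/-! If `φ α = α`, then `θ H²` is the space of all `f` with `f α = 0`: dividing by a Blaschke factor
stays in `H²`. It is closed because point evaluations are continuous, and `C_φ`-invariant because `f
(φ α) = f α`.

If `φ` has no fixed point, everything rests on Julia's inequality at a boundary point `a`: the
Poisson kernel `P z = (1 - |z|²) / |a - z|²` satisfies `P z ≤ P (φ z)` (`exists_julia_point`). It is
the limit of Schwarz–Pick inequalities for `r φ`, `r → 1`, centred at the fixed points of these
maps. Since `|θ_t| = exp (-t P)`, the quotient `(θ_t ∘ φ) / θ_t` is bounded by one, so `f = θ_t g`
gives `f ∘ φ = θ_t · ((θ_t ∘ φ) / θ_t) · (g ∘ φ)`, again in `θ_t H²`. Closedness and properness come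
from `‖g‖ ≤ ‖θ_t g‖` (`norm_le_of_eq_atomicInner_mul`), proved with means on circles only, without
boundary values.

For the Denjoy–Wolff property, `P` increases along the orbit of `0`. An interior cluster point would
force equality in Julia's inequality, making `φ` a translation in the half-plane picture, whose
orbits escape. So the orbit tends to the circle; as it stays in a horodisc at `a`, it tends to `a`,
and Schwarz–Pick carries this to compact sets. -/

theorem norm_one_sub_conj_mul_sq (w z : ℂ) :
    ‖1 - (starRingEnd ℂ) w * z‖ ^ 2 = ‖z - w‖ ^ 2 + (1 - ‖z‖ ^ 2) * (1 - ‖w‖ ^ 2) := by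
  simp only [Complex.sq_norm, Complex.normSq_apply, Complex.sub_re, Complex.sub_im, Complex.mul_re,
    Complex.mul_im, Complex.conj_re, Complex.conj_im, Complex.one_re, Complex.one_im]
  ring

theorem one_sub_norm_sq_pos {z : ℂ} (hz : z ∈ ball (0 : ℂ) 1) : 0 < 1 - ‖z‖ ^ 2 := by
  have h : ‖z‖ < 1 := by simpa using hz
  nlinarith [norm_nonneg z]

theorem one_sub_conj_mul_ne_zero {w z : ℂ} (hw : w ∈ ball (0 : ℂ) 1) (hz : z ∈ ball (0 : ℂ) 1) :
    1 - (starRingEnd ℂ) w * z ≠ 0 := by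
  intro h
  have h1 := norm_one_sub_conj_mul_sq w z
  rw [h] at h1
  have := mul_pos (one_sub_norm_sq_pos hz) (one_sub_norm_sq_pos hw)
  have := sq_nonneg ‖z - w‖
  simp at h1
  linarith

theorem one_sub_norm_blaschkeFactor_sq {α z : ℂ} (hα : α ∈ ball (0 : ℂ) 1)
    (hz : z ∈ ball (0 : ℂ) 1) :
    1 - ‖blaschkeFactor α z‖ ^ 2 =
      (1 - ‖z‖ ^ 2) * (1 - ‖α‖ ^ 2) / ‖1 - (starRingEnd ℂ) α * z‖ ^ 2 := by
  have h := norm_pos_iff.2 (one_sub_conj_mul_ne_zero hα hz)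
  have h1 := norm_one_sub_conj_mul_sq α z
  rw [blaschkeFactor, norm_div, div_pow, norm_sub_rev α z, eq_div_iff (by positivity), sub_mul,
    div_mul_cancel₀ _ (by positivity)]
  linarith

theorem blaschkeFactor_mapsTo {α : ℂ} (hα : α ∈ ball (0 : ℂ) 1) :
    MapsTo (blaschkeFactor α) (ball 0 1) (ball 0 1) := by
  intro z hz
  have h := one_sub_norm_blaschkeFactor_sq hα hz
  have h1 := norm_pos_iff.2 (one_sub_conj_mul_ne_zero hα hz)
  have h2 : 0 < 1 - ‖blaschkeFactor α z‖ ^ 2 := by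
    rw [h]
    exact div_pos (mul_pos (one_sub_norm_sq_pos hz) (one_sub_norm_sq_pos hα)) (by positivity)
  rw [mem_ball_zero_iff]
  nlinarith [norm_nonneg (blaschkeFactor α z)]

theorem differentiableOn_blaschkeFactor {α : ℂ} (hα : α ∈ ball (0 : ℂ) 1) :
    DifferentiableOn ℂ (blaschkeFactor α) (ball 0 1) := by
  apply DifferentiableOn.div
  · fun_prop
  · fun_prop
  · exact fun z hz => one_sub_conj_mul_ne_zero hα hz

theorem blaschkeFactor_blaschkeFactor {α z : ℂ} (hα : α ∈ ball (0 : ℂ) 1)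
    (hz : z ∈ ball (0 : ℂ) 1) : blaschkeFactor α (blaschkeFactor α z) = z := by
  have h := one_sub_conj_mul_ne_zero hα hz
  have h1 := one_sub_conj_mul_ne_zero hα hα
  have h2 := one_sub_conj_mul_ne_zero hα (blaschkeFactor_mapsTo hα hz)
  have h3 : blaschkeFactor α z * (1 - (starRingEnd ℂ) α * z) = α - z := div_mul_cancel₀ _ h
  rw [blaschkeFactor, div_eq_iff h2]
  linear_combination -h3

/-- Conjugating by the involutions `blaschkeFactor w` and `blaschkeFactor (φ w)` turns `φ` into a
self-map fixing `0`, to which the Schwarz lemma applies. -/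
theorem norm_blaschkeFactor_map_le {φ : ℂ → ℂ} (hφ : IsHolSelfMap φ) {w z : ℂ}
    (hw : w ∈ ball (0 : ℂ) 1) (hz : z ∈ ball (0 : ℂ) 1) :
    ‖blaschkeFactor (φ w) (φ z)‖ ≤ ‖blaschkeFactor w z‖ := by
  have hb := blaschkeFactor_mapsTo hw
  have hb' := blaschkeFactor_mapsTo (hφ.mapsTo hw)
  have hd : DifferentiableOn ℂ (fun ζ => blaschkeFactor (φ w) (φ (blaschkeFactor w ζ)))
      (ball 0 1) :=
    (differentiableOn_blaschkeFactor (hφ.mapsTo hw)).comp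
      (hφ.holo.comp (differentiableOn_blaschkeFactor hw) hb) (hφ.mapsTo.comp hb)
  have h := Complex.norm_le_norm_of_mapsTo_ball hd
    (fun ζ hζ => ball_subset_closedBall (hb' (hφ.mapsTo (hb hζ))))
    (by simp [blaschkeFactor]) (z := blaschkeFactor w z) (by simpa using hb hz)
  simpa only [blaschkeFactor_blaschkeFactor hw hz] using h

/-- The Schwarz–Pick lemma, as monotonicity of one minus the squared pseudo-hyperbolic distance. -/
theorem schwarz_pick {φ : ℂ → ℂ} (hφ : IsHolSelfMap φ) {w z : ℂ}
    (hw : w ∈ ball (0 : ℂ) 1) (hz : z ∈ ball (0 : ℂ) 1) :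
    (1 - ‖z‖ ^ 2) * (1 - ‖w‖ ^ 2) / ‖1 - (starRingEnd ℂ) w * z‖ ^ 2 ≤
      (1 - ‖φ z‖ ^ 2) * (1 - ‖φ w‖ ^ 2) / ‖1 - (starRingEnd ℂ) (φ w) * φ z‖ ^ 2 := by
  rw [← one_sub_norm_blaschkeFactor_sq hw hz,
    ← one_sub_norm_blaschkeFactor_sq (hφ.mapsTo hw) (hφ.mapsTo hz)]
  gcongr
  exact norm_blaschkeFactor_map_le hφ hw hz

/-- Scaling multiplies the numerator by exactly `r` but the denominator by more than `r`. This
strictness supplies the fixed points of `r φ`. -/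
theorem norm_blaschkeFactor_smul_lt {r : ℝ} (hr0 : 0 ≤ r) (hr1 : r < 1) {u v : ℂ}
    (hu : u ∈ ball (0 : ℂ) 1) (hv : v ∈ ball (0 : ℂ) 1) (huv : u ≠ v) :
    ‖blaschkeFactor (r * u) (r * v)‖ < ‖blaschkeFactor u v‖ := by
  have h1 := norm_pos_iff.2 (one_sub_conj_mul_ne_zero hu hv)
  have key : ‖1 - (starRingEnd ℂ) (r * u) * (r * v)‖ ^ 2 =
      r ^ 2 * ‖1 - (starRingEnd ℂ) u * v‖ ^ 2 +
        (1 - r ^ 2) * (1 - r ^ 2 * (‖u‖ ^ 2 * ‖v‖ ^ 2)) := by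
    simp only [Complex.sq_norm, Complex.normSq_apply, Complex.sub_re, Complex.sub_im,
      Complex.mul_re, Complex.mul_im, Complex.conj_re, Complex.conj_im, Complex.one_re,
      Complex.one_im, Complex.ofReal_re, Complex.ofReal_im]
    ring
  have hu1 := one_sub_norm_sq_pos hu
  have hv1 := one_sub_norm_sq_pos hv
  have hr2 : r ^ 2 < 1 := by nlinarith
  have huv1 : ‖u‖ ^ 2 * ‖v‖ ^ 2 < 1 := by nlinarith [sq_nonneg ‖u‖, sq_nonneg ‖v‖]
  have h2 : 0 < (1 - r ^ 2) * (1 - r ^ 2 * (‖u‖ ^ 2 * ‖v‖ ^ 2)) :=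
    mul_pos (by linarith) (by nlinarith [sq_nonneg r, mul_nonneg (sq_nonneg ‖u‖) (sq_nonneg ‖v‖)])
  have h3 : r * ‖1 - (starRingEnd ℂ) u * v‖ < ‖1 - (starRingEnd ℂ) (r * u) * (r * v)‖ := by
    apply lt_of_pow_lt_pow_left₀ 2 (norm_nonneg _)
    rw [key, mul_pow]
    linarith
  have h4 : 0 < ‖u - v‖ := norm_pos_iff.2 (sub_ne_zero.2 huv)
  rw [blaschkeFactor, blaschkeFactor, norm_div, norm_div, ← mul_sub, norm_mul, Complex.norm_real,
    Real.norm_of_nonneg hr0, div_lt_div_iff₀ (lt_of_le_of_lt (by positivity) h3) h1]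
  nlinarith

/-! ### Julia's lemma at a boundary fixed point -/

/-- The map `r φ` sends a compact disc into itself and strictly shrinks pseudo-hyperbolic distances
between points with distinct images. At a point minimising the displacement, one further application
would lower it. -/
theorem exists_fixed_point_smul {φ : ℂ → ℂ} (hφ : IsHolSelfMap φ) {r : ℝ} (hr0 : 0 ≤ r)
    (hr1 : r < 1) : ∃ z ∈ ball (0 : ℂ) 1, (r : ℂ) * φ z = z := by
  have hsub : closedBall (0 : ℂ) r ⊆ ball 0 1 := closedBall_subset_ball hr1
  have hmaps : ∀ z ∈ ball (0 : ℂ) 1, (r : ℂ) * φ z ∈ closedBall (0 : ℂ) r := by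
    intro z hz
    have h : ‖φ z‖ < 1 := by simpa using hφ.mapsTo hz
    rw [mem_closedBall_zero_iff, norm_mul, Complex.norm_real, Real.norm_of_nonneg hr0]
    exact mul_le_of_le_one_right hr0 h.le
  have hc : ContinuousOn (fun z => (r : ℂ) * φ z) (closedBall 0 r) :=
    continuousOn_const.mul (hφ.holo.continuousOn.mono hsub)
  have hcb : ContinuousOn (fun z => ‖blaschkeFactor z (r * φ z)‖) (closedBall 0 r) := by
    apply ContinuousOn.norm
    apply ContinuousOn.div
    · exact continuousOn_id.sub hc
    · exact continuousOn_const.sub ((Complex.continuous_conj.continuousOn).mul hc)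
    · exact fun z hz => one_sub_conj_mul_ne_zero (hsub hz) (hsub (hmaps z (hsub hz)))
  obtain ⟨z, hz, hmin⟩ := (isCompact_closedBall (0 : ℂ) r).exists_isMinOn
    ⟨0, by simpa using hr0⟩ hcb
  have hz1 := hsub hz
  have hw := hmaps z hz1
  have hw1 := hsub hw
  -- In the case of equality it is `r φ(z)`, the image of the minimiser, that is seen to be fixed.
  by_cases h : φ z = φ (r * φ z)
  · exact ⟨r * φ z, hw1, by rw [← h]⟩
  · exfalso
    have h1 := norm_blaschkeFactor_smul_lt hr0 hr1 (hφ.mapsTo hz1) (hφ.mapsTo hw1) h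
    have h2 := norm_blaschkeFactor_map_le hφ hz1 hw1
    have h3 : ‖blaschkeFactor z (r * φ z)‖ ≤ ‖blaschkeFactor (r * φ z) (r * φ (r * φ z))‖ :=
      hmin hw
    linarith

theorem one_sub_conj_mul_ne_zero_of_norm_eq_one {a z : ℂ} (ha : ‖a‖ = 1)
    (hz : z ∈ ball (0 : ℂ) 1) : 1 - (starRingEnd ℂ) a * z ≠ 0 := by
  intro h
  have h1 : ‖(starRingEnd ℂ) a * z‖ = 1 := by rw [← sub_eq_zero.1 h, norm_one]
  rw [norm_mul, RCLike.norm_conj, ha, one_mul] at h1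
  simp [h1] at hz

theorem norm_one_sub_conj_mul {a : ℂ} (ha : ‖a‖ = 1) (z : ℂ) :
    ‖1 - (starRingEnd ℂ) a * z‖ = ‖a - z‖ := by
  have h := norm_one_sub_conj_mul_sq a z
  rw [ha, norm_sub_rev z a] at h
  rw [← sq_eq_sq₀ (norm_nonneg _) (norm_nonneg _)]
  linarith

theorem sub_ne_zero_of_norm_eq_one {a z : ℂ} (ha : ‖a‖ = 1) (hz : z ∈ ball (0 : ℂ) 1) :
    a - z ≠ 0 := by
  rintro h
  rw [← sub_eq_zero.1 h, mem_ball_zero_iff] at hz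
  linarith

/-- **Wolff's lemma**: a holomorphic self-map of the disc without fixed points maps each horodisc
at a suitable boundary point `a` into itself. -/
theorem exists_julia_point {φ : ℂ → ℂ} (hφ : IsHolSelfMap φ)
    (hfix : ∀ z ∈ ball (0 : ℂ) 1, φ z ≠ z) :
    ∃ a : ℂ, ‖a‖ = 1 ∧ ∀ z ∈ ball (0 : ℂ) 1,
      (1 - ‖z‖ ^ 2) / ‖a - z‖ ^ 2 ≤ (1 - ‖φ z‖ ^ 2) / ‖a - φ z‖ ^ 2 := by
  set r : ℕ → ℝ := fun n => 1 - 1 / ((n : ℝ) + 1) with hr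
  have hr0 : ∀ n, 0 ≤ r n := fun n => by
    have : 1 / ((n : ℝ) + 1) ≤ 1 := by
      rw [div_le_one (by positivity)]
      linarith [n.cast_nonneg (α := ℝ)]
    simp only [hr]
    linarith
  have hr1 : ∀ n, r n < 1 := fun n => by
    have : 0 < 1 / ((n : ℝ) + 1) := by positivity
    simp only [hr]
    linarith
  have hrt : Tendsto r atTop (𝓝 1) := by
    have := (tendsto_one_div_add_atTop_nhds_zero_nat (𝕜 := ℝ)).const_sub 1
    simpa [hr] using this
  choose x hx hxf using fun n => exists_fixed_point_smul hφ (hr0 n) (hr1 n)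
  obtain ⟨a, ha, k, hk, hxk⟩ := (isCompact_closedBall (0 : ℂ) 1).tendsto_subseq
    (fun n => ball_subset_closedBall (hx n))
  have hrk : Tendsto (fun n => ((r (k n) : ℝ) : ℂ)) atTop (𝓝 1) := by
    have := (Complex.continuous_ofReal.tendsto 1).comp (hrt.comp hk.tendsto_atTop)
    rw [Complex.ofReal_one] at this
    exact this
  -- A cluster point inside the disc would be a fixed point of `φ`, by passing to the limit in `r
  -- φ(x) = x`.
  have ha1 : ‖a‖ = 1 := by
    by_contra hne
    have haB : a ∈ ball (0 : ℂ) 1 := by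
      rw [mem_ball_zero_iff]
      exact lt_of_le_of_ne (by simpa using ha) hne
    have hc : Tendsto (fun n => φ (x (k n))) atTop (𝓝 (φ a)) :=
      ((hφ.holo.continuousOn.continuousAt (isOpen_ball.mem_nhds haB)).tendsto).comp hxk
    have h1 := hrk.mul hc
    rw [one_mul] at h1
    exact hfix a haB (tendsto_nhds_unique h1 (hxk.congr fun n => (hxf (k n)).symm))
  refine ⟨a, ha1, fun z hz => ?_⟩
  -- As `x n` is fixed by `r n * φ`, the factor `1 - ‖x n‖ ^ 2` stands on both sides of
  -- Schwarz–Pick. It must be cancelled before the limit, where it vanishes.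
  have hstep : ∀ n, (1 - ‖z‖ ^ 2) / ‖1 - (starRingEnd ℂ) (x n) * z‖ ^ 2 ≤
      (1 - ‖(r n : ℂ) * φ z‖ ^ 2) / ‖1 - (starRingEnd ℂ) (x n) * (r n * φ z)‖ ^ 2 := by
    intro n
    have hF : IsHolSelfMap (fun z => (r n : ℂ) * φ z) := by
      refine ⟨hφ.holo.const_mul _, fun w hw => ?_⟩
      have hw' : ‖φ w‖ < 1 := by simpa using hφ.mapsTo hw
      rw [mem_ball_zero_iff, norm_mul, Complex.norm_real, Real.norm_of_nonneg (hr0 n)]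
      nlinarith [hr0 n, hr1 n, norm_nonneg (φ w)]
    have h := schwarz_pick hF (hx n) hz
    simp only [hxf n] at h
    rw [mul_div_right_comm, mul_div_right_comm] at h
    exact le_of_mul_le_mul_right h (one_sub_norm_sq_pos (hx n))
  have hconj : Tendsto (fun n => (starRingEnd ℂ) (x (k n))) atTop (𝓝 ((starRingEnd ℂ) a)) :=
    (Complex.continuous_conj.tendsto a).comp hxk
  have hL : Tendsto (fun n => (1 - ‖z‖ ^ 2) / ‖1 - (starRingEnd ℂ) (x (k n)) * z‖ ^ 2) atTop
      (𝓝 ((1 - ‖z‖ ^ 2) / ‖1 - (starRingEnd ℂ) a * z‖ ^ 2)) := by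
    apply tendsto_const_nhds.div
    · exact ((tendsto_const_nhds.sub (hconj.mul tendsto_const_nhds)).norm).pow 2
    · exact pow_ne_zero _ (norm_ne_zero_iff.2 (one_sub_conj_mul_ne_zero_of_norm_eq_one ha1 hz))
  have hR : Tendsto (fun n => (1 - ‖(r (k n) : ℂ) * φ z‖ ^ 2) /
      ‖1 - (starRingEnd ℂ) (x (k n)) * (r (k n) * φ z)‖ ^ 2) atTop
      (𝓝 ((1 - ‖1 * φ z‖ ^ 2) / ‖1 - (starRingEnd ℂ) a * (1 * φ z)‖ ^ 2)) := by
    have h1 : Tendsto (fun n => (r (k n) : ℂ) * φ z) atTop (𝓝 (1 * φ z)) :=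
      hrk.mul tendsto_const_nhds
    apply Tendsto.div
    · exact tendsto_const_nhds.sub (h1.norm.pow 2)
    · exact ((tendsto_const_nhds.sub (hconj.mul h1)).norm).pow 2
    · rw [one_mul]
      exact pow_ne_zero _ (norm_ne_zero_iff.2
        (one_sub_conj_mul_ne_zero_of_norm_eq_one ha1 (hφ.mapsTo hz)))
  have := le_of_tendsto_of_tendsto' hL hR fun n => hstep (k n)
  rwa [one_mul, norm_one_sub_conj_mul ha1, norm_one_sub_conj_mul ha1] at this

/-! ### The Denjoy–Wolff theorem for maps without fixed points -/

/-- The Cayley transform to the right half plane turns the Poisson kernel at `a` into a real part,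
and horodiscs at `a` into half planes. -/
theorem re_add_div_sub {a : ℂ} (ha : ‖a‖ = 1) (z : ℂ) :
    ((a + z) / (a - z)).re = (1 - ‖z‖ ^ 2) / ‖a - z‖ ^ 2 := by
  rw [Complex.div_re, ← add_div, Complex.sq_norm, Complex.sq_norm]
  congr 1
  have h : ‖a‖ ^ 2 = 1 := by rw [ha, one_pow]
  rw [Complex.sq_norm, Complex.normSq_apply] at h
  simp only [Complex.normSq_apply, Complex.add_re, Complex.add_im, Complex.sub_re, Complex.sub_im]
  linear_combination h

theorem differentiableOn_add_div_sub {a : ℂ} (ha : ‖a‖ = 1) :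
    DifferentiableOn ℂ (fun z => (a + z) / (a - z)) (ball 0 1) := by
  apply DifferentiableOn.div
  · fun_prop
  · fun_prop
  · exact fun z hz => sub_ne_zero_of_norm_eq_one ha hz

/-- Equality at one point in Julia's lemma makes `φ` a parabolic automorphism fixing `a`, that is, a
vertical translation of the right half plane. -/
theorem eq_translation_of_julia_eq {φ : ℂ → ℂ} (hφ : IsHolSelfMap φ) {a : ℂ} (ha : ‖a‖ = 1)
    (hJ : ∀ z ∈ ball (0 : ℂ) 1,
      (1 - ‖z‖ ^ 2) / ‖a - z‖ ^ 2 ≤ (1 - ‖φ z‖ ^ 2) / ‖a - φ z‖ ^ 2)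
    {w : ℂ} (hw : w ∈ ball (0 : ℂ) 1)
    (heq : (1 - ‖φ w‖ ^ 2) / ‖a - φ w‖ ^ 2 = (1 - ‖w‖ ^ 2) / ‖a - w‖ ^ 2) :
    ∃ c : ℂ, ∀ z ∈ ball (0 : ℂ) 1, (a + φ z) / (a - φ z) = (a + z) / (a - z) + c := by
  set G : ℂ → ℂ := fun z => (a + φ z) / (a - φ z) - (a + z) / (a - z) with hG
  have hGd : DifferentiableOn ℂ G (ball 0 1) :=
    ((differentiableOn_add_div_sub ha).comp hφ.holo hφ.mapsTo).sub
      (differentiableOn_add_div_sub ha)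
  have hre : ∀ z, (G z).re =
      (1 - ‖φ z‖ ^ 2) / ‖a - φ z‖ ^ 2 - (1 - ‖z‖ ^ 2) / ‖a - z‖ ^ 2 := fun z => by
    rw [hG, Complex.sub_re, re_add_div_sub ha, re_add_div_sub ha]
  -- `Re G` is nonnegative and vanishes at `w`. Were `G` open, its image would contain points to the
  -- left of `G w`.
  rcases (hGd.analyticOnNhd isOpen_ball).is_constant_or_isOpen
    (convex_ball 0 1).isPreconnected with ⟨c, hc⟩ | hopen
  · exact ⟨c, fun z hz => by rw [← hc z hz, hG]; ring⟩
  · exfalso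
    have h1 : G '' ball 0 1 ∈ 𝓝 (G w) :=
      (hopen _ subset_rfl isOpen_ball).mem_nhds (mem_image_of_mem G hw)
    obtain ⟨δ, hδ, hball⟩ := Metric.mem_nhds_iff.1 h1
    have hmem : G w - ((δ / 2 : ℝ) : ℂ) ∈ ball (G w) δ := by
      rw [mem_ball, dist_eq_norm, sub_sub_cancel_left, norm_neg, Complex.norm_real,
        Real.norm_of_nonneg (by positivity)]
      linarith
    obtain ⟨z, hz, hzG⟩ := hball hmem
    have h2 : (G z).re = (G w).re - δ / 2 := by rw [hzG, Complex.sub_re, Complex.ofReal_re]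
    rw [hre, hre, heq] at h2
    have := hJ z hz
    linarith

theorem iterate_mem_ball {φ : ℂ → ℂ} (hφ : IsHolSelfMap φ) {z : ℂ} (hz : z ∈ ball (0 : ℂ) 1)
    (n : ℕ) : φ^[n] z ∈ ball (0 : ℂ) 1 :=
  hφ.mapsTo.iterate n hz

theorem IsHolSelfMap.iterate {φ : ℂ → ℂ} (hφ : IsHolSelfMap φ) (n : ℕ) :
    IsHolSelfMap φ^[n] := by
  induction n with
  | zero => exact ⟨differentiableOn_id, fun _ h => h⟩
  | succ n ih =>
    rw [Function.iterate_succ]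
    exact ⟨ih.holo.comp hφ.holo hφ.mapsTo, ih.mapsTo.comp hφ.mapsTo⟩

/-- The real part of the Cayley transform increases along the orbit, so at an interior cluster point
`w` it takes equal values at `w` and `φ w`. Then `φ` is a translation by some `c`: the orbit escapes
if `c ≠ 0`, and `φ 0 = 0` if `c = 0`. -/
theorem not_tendsto_iterate_subseq {φ : ℂ → ℂ} (hφ : IsHolSelfMap φ)
    (hfix : ∀ z ∈ ball (0 : ℂ) 1, φ z ≠ z) {a : ℂ} (ha : ‖a‖ = 1)
    (hJ : ∀ z ∈ ball (0 : ℂ) 1,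
      (1 - ‖z‖ ^ 2) / ‖a - z‖ ^ 2 ≤ (1 - ‖φ z‖ ^ 2) / ‖a - φ z‖ ^ 2)
    {w : ℂ} (hw : w ∈ ball (0 : ℂ) 1) {k : ℕ → ℕ} (hk : StrictMono k) :
    ¬ Tendsto (fun n => φ^[k n] 0) atTop (𝓝 w) := by
  intro hlim
  set x : ℕ → ℂ := fun n => φ^[n] 0 with hx
  have hxb : ∀ n, x n ∈ ball (0 : ℂ) 1 := iterate_mem_ball hφ (mem_ball_self one_pos)
  have hxs : ∀ n, x (n + 1) = φ (x n) := fun n => Function.iterate_succ_apply' φ n 0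
  set M : ℂ → ℂ := fun z => (a + z) / (a - z) with hM
  have hMc : ∀ z ∈ ball (0 : ℂ) 1, ContinuousAt M z := fun z hz =>
    (differentiableOn_add_div_sub ha).continuousOn.continuousAt (isOpen_ball.mem_nhds hz)
  have hMw : Tendsto (fun n => M (x (k n))) atTop (𝓝 (M w)) := (hMc w hw).tendsto.comp hlim
  have hre : ∀ z, (M z).re = (1 - ‖z‖ ^ 2) / ‖a - z‖ ^ 2 := re_add_div_sub ha
  have hmono : Monotone fun n => (M (x n)).re := monotone_nat_of_le_succ fun n => by
    rw [hre, hre, hxs]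
    exact hJ _ (hxb n)
  have hsub : Tendsto (fun n => (M (x (k n))).re) atTop (𝓝 (M w).re) :=
    (Complex.continuous_re.tendsto _).comp hMw
  have hall : Tendsto (fun n => (M (x n)).re) atTop (𝓝 (M w).re) :=
    (tendsto_iff_tendsto_subseq_of_monotone hmono hk.tendsto_atTop).2 hsub
  have hφw : Tendsto (fun n => (M (x (k n + 1))).re) atTop (𝓝 (M (φ w)).re) := by
    have h1 : Tendsto (fun n => φ (x (k n))) atTop (𝓝 (φ w)) :=
      (hφ.holo.continuousOn.continuousAt (isOpen_ball.mem_nhds hw)).tendsto.comp hlim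
    have h2 := (Complex.continuous_re.tendsto _).comp ((hMc _ (hφ.mapsTo hw)).tendsto.comp h1)
    exact h2.congr fun n => by simp only [Function.comp_apply, hxs]
  have heq : (M (φ w)).re = (M w).re :=
    tendsto_nhds_unique hφw
      (hall.comp (tendsto_atTop_mono (fun n => Nat.le_succ (k n)) hk.tendsto_atTop))
  rw [hre, hre] at heq
  obtain ⟨c, hc⟩ := eq_translation_of_julia_eq hφ ha hJ hw heq
  have hiter : ∀ n : ℕ, M (x n) = 1 + n * c := by
    intro n
    induction n with
    | zero =>
      have ha0 : a ≠ 0 := norm_ne_zero_iff.1 (by rw [ha]; exact one_ne_zero)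
      simp [hM, hx, ha0]
    | succ n ih =>
      have h := hc (x n) (hxb n)
      rw [hxs]
      change M (φ (x n)) = M (x n) + c at h
      rw [h, ih]
      push_cast
      ring
  have hc0 : c = 0 := by
    by_contra hne
    have h1 : Tendsto (fun n : ℕ => ‖M (x n) - 1‖) atTop atTop := by
      simp only [hiter, add_sub_cancel_left, norm_mul, Complex.norm_natCast]
      exact tendsto_natCast_atTop_atTop.atTop_mul_const (norm_pos_iff.2 hne)
    exact not_tendsto_nhds_of_tendsto_atTop (h1.comp hk.tendsto_atTop) _
      (hMw.sub_const 1).norm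
  apply hfix 0 (mem_ball_self one_pos)
  have h := hc 0 (mem_ball_self one_pos)
  have h0 := sub_ne_zero_of_norm_eq_one ha (hφ.mapsTo (mem_ball_self one_pos))
  have ha0 : a ≠ 0 := norm_ne_zero_iff.1 (by rw [ha]; exact one_ne_zero)
  rw [hc0, add_zero, add_zero, sub_zero, div_self ha0, div_eq_one_iff_eq h0] at h
  linear_combination h / 2

theorem tendsto_norm_iterate_zero {φ : ℂ → ℂ} (hφ : IsHolSelfMap φ)
    (hfix : ∀ z ∈ ball (0 : ℂ) 1, φ z ≠ z) {a : ℂ} (ha : ‖a‖ = 1)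
    (hJ : ∀ z ∈ ball (0 : ℂ) 1,
      (1 - ‖z‖ ^ 2) / ‖a - z‖ ^ 2 ≤ (1 - ‖φ z‖ ^ 2) / ‖a - φ z‖ ^ 2) :
    Tendsto (fun n => ‖φ^[n] 0‖) atTop (𝓝 1) := by
  rw [tendsto_order]
  refine ⟨fun s hs => ?_, fun s hs => Eventually.of_forall fun n => ?_⟩
  · by_contra hnot
    obtain ⟨w, hw, k, hk, hlim⟩ := (isCompact_closedBall (0 : ℂ) s).tendsto_subseq'
      (x := fun n => φ^[n] 0) ((not_eventually.1 hnot).mono fun n hn => by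
        simpa using hn)
    exact not_tendsto_iterate_subseq hφ hfix ha hJ (closedBall_subset_ball hs hw) hk hlim
  · have : ‖φ^[n] 0‖ < 1 := by simpa using iterate_mem_ball hφ (mem_ball_self one_pos) n
    linarith

theorem tendsto_iterate_zero {φ : ℂ → ℂ} (hφ : IsHolSelfMap φ)
    (hfix : ∀ z ∈ ball (0 : ℂ) 1, φ z ≠ z) {a : ℂ} (ha : ‖a‖ = 1)
    (hJ : ∀ z ∈ ball (0 : ℂ) 1,
      (1 - ‖z‖ ^ 2) / ‖a - z‖ ^ 2 ≤ (1 - ‖φ z‖ ^ 2) / ‖a - φ z‖ ^ 2) :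
    Tendsto (fun n => φ^[n] 0) atTop (𝓝 a) := by
  have hb : ∀ n, φ^[n] 0 ∈ ball (0 : ℂ) 1 := iterate_mem_ball hφ (mem_ball_self one_pos)
  -- The Poisson kernel equals `1` at the origin, so the orbit never leaves the horodisc where it is
  -- at least `1`.
  have hone : ∀ n, 1 ≤ (1 - ‖φ^[n] 0‖ ^ 2) / ‖a - φ^[n] 0‖ ^ 2 := by
    intro n
    induction n with
    | zero => simp [ha]
    | succ n ih =>
      rw [Function.iterate_succ_apply']
      exact ih.trans (hJ _ (hb n))
  have hle : ∀ n, ‖φ^[n] 0 - a‖ ^ 2 ≤ 1 - ‖φ^[n] 0‖ ^ 2 := fun n => by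
    have h := norm_pos_iff.2 (sub_ne_zero_of_norm_eq_one ha (hb n))
    have := (one_le_div (by positivity)).1 (hone n)
    rwa [norm_sub_rev]
  have h1 : Tendsto (fun n => 1 - ‖φ^[n] 0‖ ^ 2) atTop (𝓝 0) := by
    have := ((tendsto_norm_iterate_zero hφ hfix ha hJ).pow 2).const_sub 1
    simpa using this
  have h2 : Tendsto (fun n => ‖φ^[n] 0 - a‖ ^ 2) atTop (𝓝 0) :=
    squeeze_zero (fun n => by positivity) hle h1
  rw [tendsto_iff_norm_sub_tendsto_zero]
  have h3 := h2.sqrt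
  simpa [Real.sqrt_sq] using h3

/-- Schwarz–Pick between `0` and `z`. Applied to the iterates, the bound tends to zero uniformly on
`‖z‖ ≤ s`, because their values at `0` approach the circle. -/
theorem norm_iterate_sub_iterate_zero_sq_le {φ : ℂ → ℂ} (hφ : IsHolSelfMap φ) {s : ℝ}
    (hs1 : s < 1) {z : ℂ} (hz : ‖z‖ ≤ s) :
    ‖φ z - φ 0‖ ^ 2 ≤ (1 - ‖φ 0‖ ^ 2) / (1 - s ^ 2) := by
  have hzb : z ∈ ball (0 : ℂ) 1 := by simpa using hz.trans_lt hs1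
  have hs0 : 0 ≤ s := (norm_nonneg z).trans hz
  have h0 : (0 : ℂ) ∈ ball (0 : ℂ) 1 := mem_ball_self one_pos
  have h := schwarz_pick hφ h0 hzb
  have hp := norm_pos_iff.2 (one_sub_conj_mul_ne_zero (hφ.mapsTo h0) (hφ.mapsTo hzb))
  have hid := norm_one_sub_conj_mul_sq (φ 0) (φ z)
  have h1 := one_sub_norm_sq_pos (hφ.mapsTo h0)
  have h2 := one_sub_norm_sq_pos (hφ.mapsTo hzb)
  have hz2 : ‖z‖ ^ 2 ≤ s ^ 2 := by gcongr
  have hs2 : 0 < 1 - s ^ 2 := by nlinarith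
  simp only [norm_zero, map_zero, zero_mul, sub_zero, norm_one, one_pow, div_one, mul_one,
    ne_eq, OfNat.ofNat_ne_zero, not_false_eq_true, zero_pow] at h
  rw [le_div_iff₀ (by positivity)] at h
  rw [le_div_iff₀ hs2]
  have h3 : (1 - s ^ 2) * ‖1 - (starRingEnd ℂ) (φ 0) * φ z‖ ^ 2 ≤
      (1 - ‖z‖ ^ 2) * ‖1 - (starRingEnd ℂ) (φ 0) * φ z‖ ^ 2 := by gcongr
  have h4 : (1 - ‖φ z‖ ^ 2) * (1 - ‖φ 0‖ ^ 2) ≤ 1 - ‖φ 0‖ ^ 2 :=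
    mul_le_of_le_one_left h1.le (by linarith [sq_nonneg ‖φ z‖])
  have h5 : ‖φ z - φ 0‖ ^ 2 ≤ ‖1 - (starRingEnd ℂ) (φ 0) * φ z‖ ^ 2 := by
    rw [hid]
    linarith [mul_pos h2 h1]
  calc ‖φ z - φ 0‖ ^ 2 * (1 - s ^ 2)
      ≤ ‖1 - (starRingEnd ℂ) (φ 0) * φ z‖ ^ 2 * (1 - s ^ 2) := by gcongr
    _ ≤ 1 - ‖φ 0‖ ^ 2 := by linarith

theorem isDenjoyWolffPoint_of_julia {φ : ℂ → ℂ} (hφ : IsHolSelfMap φ)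
    (hfix : ∀ z ∈ ball (0 : ℂ) 1, φ z ≠ z) {a : ℂ} (ha : ‖a‖ = 1)
    (hJ : ∀ z ∈ ball (0 : ℂ) 1,
      (1 - ‖z‖ ^ 2) / ‖a - z‖ ^ 2 ≤ (1 - ‖φ z‖ ^ 2) / ‖a - φ z‖ ^ 2) :
    IsDenjoyWolffPoint φ a := by
  refine ⟨by simp [ha], fun K hK hKc => ?_⟩
  obtain ⟨s, hs1, hKs⟩ : ∃ s < 1, K ⊆ closedBall 0 s := by
    rcases K.eq_empty_or_nonempty with rfl | hne
    · exact ⟨0, one_pos, empty_subset _⟩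
    · obtain ⟨z, hz, hmax⟩ := hKc.exists_isMaxOn hne continuous_norm.continuousOn
      exact ⟨‖z‖, by simpa using hK hz, fun y hy => by simpa using hmax hy⟩
  have h1 : Tendsto (fun n => √((1 - ‖φ^[n] 0‖ ^ 2) / (1 - s ^ 2)) + ‖φ^[n] 0 - a‖) atTop
      (𝓝 0) := by
    have h2 := (((((tendsto_norm_iterate_zero hφ hfix ha hJ).pow 2).const_sub 1).div_const
      (1 - s ^ 2)).sqrt).add
      (tendsto_iff_norm_sub_tendsto_zero.1 (tendsto_iterate_zero hφ hfix ha hJ))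
    simpa using h2
  rw [Metric.tendstoUniformlyOn_iff]
  intro ε hε
  filter_upwards [h1.eventually_lt_const hε] with n hn z hz
  refine lt_of_le_of_lt ?_ hn
  rw [dist_comm, dist_eq_norm, ← sub_add_sub_cancel _ (φ^[n] 0) a]
  refine (norm_add_le _ _).trans ?_
  gcongr
  apply Real.le_sqrt_of_sq_le
  exact norm_iterate_sub_iterate_zero_sq_le (hφ.iterate n) hs1 (by simpa using hKs hz)

/-! ### Means, point evaluations and multipliers -/

theorem mean_le_mean_of_norm_le {f g : ℂ → ℂ} (hf : DifferentiableOn ℂ f (ball 0 1))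
    (hg : DifferentiableOn ℂ g (ball 0 1)) {r : ℝ} (hr : r ∈ Ico (0 : ℝ) 1)
    (h : ∀ z ∈ sphere (0 : ℂ) r, ‖f z‖ ≤ ‖g z‖) : mean f r ≤ mean g r := by
  apply Real.sqrt_le_sqrt
  apply Real.circleAverage_mono (circleIntegrable hf hr) (circleIntegrable hg hr)
  intro z hz
  rw [abs_of_nonneg hr.1] at hz
  have := h z hz
  gcongr

theorem mean_congr {f g : ℂ → ℂ} {r : ℝ} (hr : r ∈ Ico (0 : ℝ) 1)
    (h : ∀ z ∈ ball (0 : ℂ) 1, f z = g z) : mean f r = mean g r := by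
  unfold mean
  congr 1
  apply Real.circleAverage_congr_sphere
  intro z hz
  simp [h z (sphere_subset hr hz)]

/-- The `L²` means of a holomorphic function increase with the radius. -/
theorem mean_mono {f : ℂ → ℂ} (hf : DifferentiableOn ℂ f (ball 0 1)) {r R : ℝ} (hr : 0 ≤ r)
    (hrR : r ≤ R) (hR1 : R < 1) : mean f r ≤ mean f R := by
  rcases hrR.eq_or_lt with rfl | hlt
  · exact le_rfl
  have hR0 : 0 < R := hr.trans_lt hlt
  have hrI : r ∈ Ico (0 : ℝ) 1 := ⟨hr, hlt.trans hR1⟩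
  have hRI : R ∈ Ico (0 : ℝ) 1 := ⟨hR0.le, hR1⟩
  -- `Re H` is the Poisson integral of `|f|²` from the circle of radius `R`. It majorises `|f|²`,
  -- and its mean over the smaller circle is `Re (H 0)`, which is at most the mean of `|f|²` over
  -- the larger one.
  set H : ℂ → ℂ := fun w => Real.circleAverage
      (fun ζ => herglotzRieszKernel 0 w ζ • ((‖f ζ‖ ^ 2 : ℝ) : ℂ)) 0 R with hH
  have hci : CircleIntegrable (fun ζ => ((‖f ζ‖ ^ 2 : ℝ) : ℂ)) 0 R := by
    apply ContinuousOn.circleIntegrable'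
    exact Complex.continuous_ofReal.comp_continuousOn
      ((hf.continuousOn.mono (sphere_subset hRI)).norm.pow 2)
  have hHd : DifferentiableOn ℂ H (ball 0 R) :=
    differentiableOn_circleAverage_herglotzRieszKernel_smul hci
  have hsub : closedBall (0 : ℂ) r ⊆ ball 0 R := closedBall_subset_ball hlt
  have hcl : closure (ball (0 : ℂ) |r|) ⊆ ball 0 R := by
    rw [abs_of_nonneg hr]
    exact closure_ball_subset_closedBall.trans hsub
  have hsph : sphere (0 : ℂ) |r| ⊆ ball 0 R := by
    rw [abs_of_nonneg hr]
    exact sphere_subset_closedBall.trans hsub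
  have hmv : Real.circleAverage H 0 r = H 0 := (hHd.mono hcl).diffContOnCl.circleAverage
  have hint : CircleIntegrable H 0 r := (hHd.continuousOn.mono hsph).circleIntegrable'
  have hre : Real.circleAverage (fun z => (H z).re) 0 r = (H 0).re := by
    have := Complex.reCLM.circleAverage_comp_comm hint
    rw [hmv] at this
    exact this
  rw [mean_le_iff _ _ (mean_nonneg _ _)]
  calc Real.circleAverage (fun z => ‖f z‖ ^ 2) 0 r
      ≤ Real.circleAverage (fun z => (H z).re) 0 r := by
        apply Real.circleAverage_mono (circleIntegrable hf hrI)
        · apply ContinuousOn.circleIntegrable'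
          exact Complex.continuous_re.comp_continuousOn (hHd.continuousOn.mono hsph)
        · exact fun z hz => sq_le_herglotz hf hR0 hR1 (hsph hz)
    _ = (H 0).re := hre
    _ ≤ (R + ‖(0 : ℂ)‖) / (R - ‖(0 : ℂ)‖) * mean f R ^ 2 :=
        herglotz_le hf hR0 hR1 (mem_ball_self hR0)
    _ = mean f R ^ 2 := by rw [norm_zero, add_zero, sub_zero, div_self hR0.ne', one_mul]

/-- Harnack's bound for the Poisson majorant on the circle of radius `R`, with `R → 1`. -/
theorem norm_apply_sq_le (f : H2) {w : ℂ} (hw : w ∈ ball (0 : ℂ) 1) :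
    ‖f w‖ ^ 2 ≤ (1 + ‖w‖) / (1 - ‖w‖) * ‖f‖ ^ 2 := by
  have hw1 : ‖w‖ < 1 := by simpa using hw
  have hlim : Tendsto (fun R : ℝ => (R + ‖w‖) / (R - ‖w‖) * ‖f‖ ^ 2) (𝓝[<] 1)
      (𝓝 ((1 + ‖w‖) / (1 - ‖w‖) * ‖f‖ ^ 2)) := by
    have hid : Tendsto (fun R : ℝ => R) (𝓝[<] 1) (𝓝 1) := nhdsWithin_le_nhds
    exact ((hid.add_const _).div (hid.sub_const _) (by linarith)).mul_const _
  refine ge_of_tendsto hlim ?_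
  filter_upwards [Ioo_mem_nhdsLT hw1] with R hR
  have hR0 : 0 < R := (norm_nonneg w).trans_lt hR.1
  refine ((sq_le_herglotz f.isHardy.holo hR0 hR.2 (by simpa using hR.1)).trans
    (herglotz_le f.isHardy.holo hR0 hR.2 (by simpa using hR.1))).trans ?_
  have h1 := f.mean_le_norm ⟨hR0.le, hR.2⟩
  have h2 := mean_nonneg f R
  have h3 : 0 ≤ (R + ‖w‖) / (R - ‖w‖) :=
    div_nonneg (by positivity) (by linarith [hR.1])
  gcongr

theorem norm_apply_zero_le (f : H2) : ‖f 0‖ ≤ ‖f‖ := by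
  have h := norm_apply_sq_le f (mem_ball_self one_pos)
  simp only [norm_zero, add_zero, sub_zero, div_one, one_mul] at h
  exact le_of_sq_le_sq h (norm_nonneg _)

theorem sub_fn (f g : H2) : H2.fn (f - g) = H2.fn f - H2.fn g := rfl

theorem continuous_apply {w : ℂ} (hw : w ∈ ball (0 : ℂ) 1) : Continuous fun f : H2 => f w := by
  let L : H2 →ₗ[ℂ] ℂ :=
    { toFun := fun f => f w
      map_add' := fun _ _ => rfl
      map_smul' := fun _ _ => rfl }
  have hw1 : ‖w‖ < 1 := by simpa using hw
  have hC : 0 ≤ (1 + ‖w‖) / (1 - ‖w‖) := div_nonneg (by positivity) (by linarith)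
  refine (L.mkContinuous √((1 + ‖w‖) / (1 - ‖w‖)) fun f => ?_).continuous
  apply le_of_sq_le_sq _ (by positivity)
  rw [mul_pow, Real.sq_sqrt hC]
  exact norm_apply_sq_le f hw

theorem isHardy_indicator {f : ℂ → ℂ} (hf : DifferentiableOn ℂ f (ball 0 1)) {C : ℝ}
    (hC : ∀ r ∈ Ico (0 : ℝ) 1, mean f r ≤ C) : IsHardy ((ball (0 : ℂ) 1).indicator f) := by
  refine ⟨hf.congr fun z hz => indicator_of_mem hz _, fun z hz => indicator_of_notMem hz _, C, ?_⟩
  rintro _ ⟨r, hr, rfl⟩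
  rw [mean_indicator _ hr]
  exact hC r hr

theorem mean_mul_le {h : ℂ → ℂ} (hh : DifferentiableOn ℂ h (ball 0 1))
    (hh1 : ∀ z ∈ ball (0 : ℂ) 1, ‖h z‖ ≤ 1) {f : ℂ → ℂ} (hf : DifferentiableOn ℂ f (ball 0 1))
    {r : ℝ} (hr : r ∈ Ico (0 : ℝ) 1) : mean (fun z => h z * f z) r ≤ mean f r := by
  apply mean_le_mean_of_norm_le (hh.mul hf) hf hr
  intro z hz
  rw [Pi.mul_apply, norm_mul]
  refine mul_le_of_le_one_left (norm_nonneg _) (hh1 z (sphere_subset hr ?_))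
  rwa [abs_of_nonneg hr.1]

/-- Multiplication of `f ∈ H²` by a holomorphic function bounded by one. -/
noncomputable def contractiveMul (h : ℂ → ℂ) (hh : DifferentiableOn ℂ h (ball 0 1))
    (hh1 : ∀ z ∈ ball (0 : ℂ) 1, ‖h z‖ ≤ 1) (f : H2) : H2 :=
  H2.mk ((ball (0 : ℂ) 1).indicator fun z => h z * f z)
    (isHardy_indicator (hh.mul f.isHardy.holo) fun _ hr =>
      (mean_mul_le hh hh1 f.isHardy.holo hr).trans (f.mean_le_norm hr))

theorem contractiveMul_apply {h : ℂ → ℂ} (hh : DifferentiableOn ℂ h (ball 0 1))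
    (hh1 : ∀ z ∈ ball (0 : ℂ) 1, ‖h z‖ ≤ 1) (f : H2) {z : ℂ} (hz : z ∈ ball (0 : ℂ) 1) :
    contractiveMul h hh hh1 f z = h z * f z :=
  indicator_of_mem hz fun z => h z * f z

theorem mean_one (r : ℝ) : mean (fun _ => 1) r = 1 := by
  simp [mean, Real.circleAverage_const]

/-- The constant function one. -/
noncomputable def one : H2 :=
  H2.mk ((ball (0 : ℂ) 1).indicator fun _ => 1)
    (isHardy_indicator (differentiableOn_const 1) fun r _ => (mean_one r).le)

theorem one_apply {z : ℂ} (hz : z ∈ ball (0 : ℂ) 1) : one z = 1 :=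
  indicator_of_mem hz fun _ => (1 : ℂ)

theorem norm_one_le : ‖one‖ ≤ 1 :=
  H2.norm_le_of _ fun r hr => ((mean_indicator _ hr).trans (mean_one r)).le

theorem shiftOp_mem_mulRange {θ : ℂ → ℂ} {f : H2} (hf : f ∈ mulRange θ) :
    shiftOp f ∈ mulRange θ := by
  obtain ⟨g, hg⟩ := hf
  refine ⟨shiftOp g, fun z hz => ?_⟩
  rw [shiftOp_apply, shiftOp_apply, hg z hz]
  ring

/-! ### The subspace of a Blaschke factor -/

theorem le_norm_blaschkeFactor {α z : ℂ} (hα : ‖α‖ < 1) (hz : ‖z‖ < 1)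
    (h : (1 + ‖α‖) / 2 ≤ ‖z‖) : (1 - ‖α‖) / 4 ≤ ‖blaschkeFactor α z‖ := by
  have h0 := norm_pos_iff.2 (one_sub_conj_mul_ne_zero (w := α) (z := z) (by simpa using hα)
    (by simpa using hz))
  rw [blaschkeFactor, norm_div, le_div_iff₀ h0]
  have h1 : ‖z‖ - ‖α‖ ≤ ‖α - z‖ := by
    rw [norm_sub_rev]
    exact norm_sub_norm_le z α
  have h2 : ‖1 - (starRingEnd ℂ) α * z‖ ≤ 2 := by
    refine (norm_sub_le _ _).trans ?_
    rw [norm_one, norm_mul, RCLike.norm_conj]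
    nlinarith [norm_nonneg α, norm_nonneg z]
  nlinarith

theorem mem_mulRange_blaschkeFactor_iff {α : ℂ} (hα : α ∈ ball (0 : ℂ) 1) (f : H2) :
    f ∈ mulRange (blaschkeFactor α) ↔ f α = 0 := by
  constructor
  · rintro ⟨g, hg⟩
    rw [hg α hα, blaschkeFactor, sub_self, zero_div, zero_mul]
  intro hf
  have hα1 : ‖α‖ < 1 := by simpa using hα
  -- The quotient of `f` by the Blaschke factor, with the singularity at `α` removed by `dslope`;
  -- the sign comes from the numerator `α - z`.
  set g : ℂ → ℂ := fun z => -(1 - (starRingEnd ℂ) α * z) * dslope f α z with hg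
  have hgd : DifferentiableOn ℂ g (ball 0 1) := by
    apply DifferentiableOn.mul
    · fun_prop
    · exact (Complex.differentiableOn_dslope (isOpen_ball.mem_nhds hα)).2 f.isHardy.holo
  have hfg : ∀ z ∈ ball (0 : ℂ) 1, f z = blaschkeFactor α z * g z := by
    intro z hz
    have h1 := one_sub_conj_mul_ne_zero hα hz
    have h2 := sub_smul_dslope f α z
    rw [hf, sub_zero, smul_eq_mul] at h2
    have h3 : blaschkeFactor α z * (1 - (starRingEnd ℂ) α * z) = α - z := div_mul_cancel₀ _ h1
    simp only [hg]
    linear_combination -h2 + dslope f α z * h3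
  clear_value g
  have hb : ∀ r ∈ Ico (0 : ℝ) 1, mean g r ≤ 4 / (1 - ‖α‖) * ‖f‖ := by
    intro r hr
    -- Means grow with the radius, so the circle may be pushed out past the zero `α`, to where the
    -- Blaschke factor is bounded below.
    set R := max r ((1 + ‖α‖) / 2)
    have hR1 : R < 1 := max_lt hr.2 (by linarith)
    have hRI : R ∈ Ico (0 : ℝ) 1 := ⟨hr.1.trans (le_max_left _ _), hR1⟩
    refine (mean_mono hgd hr.1 (le_max_left _ _) hR1).trans ?_
    have hc : ‖((4 / (1 - ‖α‖) : ℝ) : ℂ)‖ = 4 / (1 - ‖α‖) := by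
      rw [Complex.norm_real, Real.norm_of_nonneg (div_nonneg (by norm_num) (by linarith))]
    calc mean g R ≤ mean (((4 / (1 - ‖α‖) : ℝ) : ℂ) • H2.fn f) R := by
          apply mean_le_mean_of_norm_le hgd (f.isHardy.holo.const_smul _) hRI
          intro z hz
          have hzR : ‖z‖ = R := by simpa using hz
          have hz1 : ‖z‖ < 1 := hzR ▸ hR1
          have h1 := le_norm_blaschkeFactor hα1 hz1 (hzR ▸ le_max_right _ _)
          rw [Pi.smul_apply, norm_smul, hc, hfg z (by simpa using hz1), norm_mul, ← mul_assoc]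
          refine le_mul_of_one_le_left (norm_nonneg _) ?_
          rw [div_mul_eq_mul_div, one_le_div (by linarith)]
          linarith
      _ = 4 / (1 - ‖α‖) * mean f R := by rw [mean_smul, hc]
      _ ≤ 4 / (1 - ‖α‖) * ‖f‖ :=
          mul_le_mul_of_nonneg_left (f.mean_le_norm hRI) (div_nonneg (by norm_num) (by linarith))
  exact ⟨H2.mk _ (isHardy_indicator hgd hb), fun z hz => by
    rw [hfg z hz, H2.mk_fn, indicator_of_mem hz]⟩

theorem mulRange_blaschkeFactor_mem_lat {φ : ℂ → ℂ} (hφ : IsHolSelfMap φ) {α : ℂ}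
    (hα : α ∈ ball (0 : ℂ) 1) (hfix : φ α = α) :
    mulRange (blaschkeFactor α) ≠ ⊥ ∧ mulRange (blaschkeFactor α) ≠ ⊤ ∧
      mulRange (blaschkeFactor α) ∈ Lat (compOp φ hφ) ∩ Lat shiftOp := by
  have hcl : IsClosed (mulRange (blaschkeFactor α) : Set H2) := by
    have : (mulRange (blaschkeFactor α) : Set H2) = {f : H2 | f α = 0} :=
      Set.ext fun f => mem_mulRange_blaschkeFactor_iff hα f
    rw [this]
    exact isClosed_eq (continuous_apply hα) continuous_const
  refine ⟨fun hbot => ?_, fun htop => ?_, ⟨hcl, fun f hf => ?_⟩,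
    hcl, fun f hf => shiftOp_mem_mulRange hf⟩
  -- The function `z - α` vanishes at `α` and takes different values at `0` and `1/2`, so it is a
  -- nonzero element.
  · set f : H2 := shiftOp one - α • one with hf
    have hfz : ∀ z ∈ ball (0 : ℂ) 1, f z = z - α := fun z hz => by
      rw [hf, sub_fn, Pi.sub_apply, shiftOp_apply, H2.smul_fn, Pi.smul_apply, one_apply hz,
        smul_eq_mul, mul_one, mul_one]
    have hmem : f ∈ mulRange (blaschkeFactor α) := by
      rw [mem_mulRange_blaschkeFactor_iff hα, hfz α hα, sub_self]
    rw [hbot, Submodule.mem_bot] at hmem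
    have h0 := hfz 0 (mem_ball_self one_pos)
    have h1 := hfz (1 / 2) (by rw [mem_ball_zero_iff]; norm_num)
    rw [hmem, H2.zero_fn, Pi.zero_apply] at h0 h1
    have h2 : (1 / 2 : ℂ) = 0 := by linear_combination h0 - h1
    norm_num at h2
  · have hmem : one ∈ mulRange (blaschkeFactor α) := htop ▸ Submodule.mem_top
    rw [mem_mulRange_blaschkeFactor_iff hα, one_apply hα] at hmem
    exact one_ne_zero hmem
  · rw [mem_mulRange_blaschkeFactor_iff hα] at hf ⊢
    rw [compOp_apply hφ f hα, hfix, hf]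

/-! ### The subspace of an atomic singular inner function -/

theorem norm_atomicInner (t : ℝ) {a : ℂ} (ha : ‖a‖ = 1) (z : ℂ) :
    ‖atomicInner t a z‖ = Real.exp (-(t * ((1 - ‖z‖ ^ 2) / ‖a - z‖ ^ 2))) := by
  have h : (z + a) / (z - a) = -((a + z) / (a - z)) := by
    rw [← neg_sub a z, div_neg, add_comm]
  rw [atomicInner, Complex.norm_exp, Complex.re_ofReal_mul, h, Complex.neg_re, re_add_div_sub ha,
    mul_neg]

theorem atomicInner_ne_zero (t : ℝ) (a z : ℂ) : atomicInner t a z ≠ 0 := Complex.exp_ne_zero _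

theorem differentiableOn_atomicInner (t : ℝ) {a : ℂ} (ha : ‖a‖ = 1) :
    DifferentiableOn ℂ (atomicInner t a) (ball 0 1) := by
  apply DifferentiableOn.cexp
  apply DifferentiableOn.const_mul
  apply DifferentiableOn.div
  · fun_prop
  · fun_prop
  · intro z hz h
    exact sub_ne_zero_of_norm_eq_one ha hz (by rw [← neg_sub, h, neg_zero])

theorem norm_atomicInner_le_one {t : ℝ} (ht : 0 ≤ t) {a : ℂ} (ha : ‖a‖ = 1) {z : ℂ}
    (hz : z ∈ ball (0 : ℂ) 1) : ‖atomicInner t a z‖ ≤ 1 := by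
  rw [norm_atomicInner t ha, Real.exp_le_one_iff, neg_nonpos]
  exact mul_nonneg ht (div_nonneg (one_sub_norm_sq_pos hz).le (by positivity))

theorem one_sub_norm_atomicInner_sq_le (t : ℝ) {a : ℂ} (ha : ‖a‖ = 1) (z : ℂ) :
    1 - ‖atomicInner t a z‖ ^ 2 ≤ 2 * t * ((1 - ‖z‖ ^ 2) / ‖a - z‖ ^ 2) := by
  rw [norm_atomicInner t ha, ← Real.exp_nat_mul]
  have := Real.add_one_le_exp ((2 : ℕ) * -(t * ((1 - ‖z‖ ^ 2) / ‖a - z‖ ^ 2)))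
  push_cast at this ⊢
  linarith

theorem sub_ne_zero_of_lt {a : ℂ} (ha : ‖a‖ = 1) {ε : ℝ} (hε : 0 ≤ ε) {z : ℂ}
    (hz : z ∈ ball (0 : ℂ) 1) : (1 + ε : ℝ) * a - z ≠ 0 := by
  intro h
  have h1 : ‖z‖ = 1 + ε := by
    rw [← sub_eq_zero.1 h, norm_mul, ha, mul_one, Complex.norm_real,
      Real.norm_of_nonneg (by linarith)]
  have : ‖z‖ < 1 := by simpa using hz
  linarith

theorem le_norm_sub {a : ℂ} (ha : ‖a‖ = 1) {ε : ℝ} (hε : 0 ≤ ε) {z : ℂ}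
    (hz : z ∈ ball (0 : ℂ) 1) : ε ≤ ‖(1 + ε : ℝ) * a - z‖ := by
  have h := norm_sub_norm_le ((1 + ε : ℝ) * a) z
  rw [norm_mul, ha, mul_one, Complex.norm_real, Real.norm_of_nonneg (by linarith)] at h
  have : ‖z‖ < 1 := by simpa using hz
  linarith

/-- Moving radially outward from `a` goes away from every point of the disc. Hence the damping
factor below has modulus at most one. -/
theorem norm_sub_le_norm_sub {a : ℂ} (ha : ‖a‖ = 1) {ε : ℝ} (hε : 0 ≤ ε) {z : ℂ}
    (hz : z ∈ ball (0 : ℂ) 1) : ‖a - z‖ ≤ ‖(1 + ε : ℝ) * a - z‖ := by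
  apply le_of_sq_le_sq _ (norm_nonneg _)
  have h1 : ‖(1 + ε : ℝ) * a - z‖ ^ 2 =
      ‖a - z‖ ^ 2 + ε * (2 * (‖a‖ ^ 2 - (a.re * z.re + a.im * z.im)) + ε * ‖a‖ ^ 2) := by
    simp only [Complex.sq_norm, Complex.normSq_apply, Complex.sub_re, Complex.sub_im,
      Complex.mul_re, Complex.mul_im, Complex.ofReal_re, Complex.ofReal_im]
    ring
  have h2 : 2 * (a.re * z.re + a.im * z.im) ≤ ‖a‖ ^ 2 + ‖z‖ ^ 2 := by
    simp only [Complex.sq_norm, Complex.normSq_apply]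
    nlinarith [sq_nonneg (a.re - z.re), sq_nonneg (a.im - z.im)]
  have h3 := one_sub_norm_sq_pos hz
  rw [h1, ha] at *
  have : 0 ≤ ε * (2 * (1 ^ 2 - (a.re * z.re + a.im * z.im)) + ε * 1 ^ 2) :=
    mul_nonneg hε (by linarith)
  linarith

/-- If `f = θ g` with `θ` an atomic singular inner function at `a`, then the means of `g`, damped near
`a` by the factor `(a - z) / ((1 + ε) a - z)`, are bounded by the norm of `f`. -/
theorem mean_damped_le {t : ℝ} (ht : 0 ≤ t) {a : ℂ} (ha : ‖a‖ = 1) {f g : H2}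
    (hfg : ∀ z ∈ ball (0 : ℂ) 1, f z = atomicInner t a z * g z) {ε : ℝ} (hε : 0 < ε) {r : ℝ}
    (hr : r ∈ Ico (0 : ℝ) 1) :
    mean (fun z => (a - z) / ((1 + ε : ℝ) * a - z) * g z) r ≤ ‖f‖ := by
  set h : ℂ → ℂ := fun z => (a - z) / ((1 + ε : ℝ) * a - z) with hh
  have hd : DifferentiableOn ℂ h (ball 0 1) := by
    apply DifferentiableOn.div
    · fun_prop
    · fun_prop
    · exact fun z hz => sub_ne_zero_of_lt ha hε.le hz
  have hnorm : ∀ z, ‖h z‖ = ‖a - z‖ / ‖(1 + ε : ℝ) * a - z‖ := fun z => norm_div _ _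
  -- Split `|h g|²` as `|h|² |θ|² |g|² + |h|² (1 - |θ|²) |g|²`. In the second term `1 - |θ|²` is at
  -- most `2 t` times the Poisson kernel, whose denominator `|a - z|²` is cancelled by the zero of
  -- `h` at `a`.
  have hpt : ∀ z ∈ ball (0 : ℂ) 1,
      ‖h z * g z‖ ^ 2 ≤ ‖f z‖ ^ 2 + 2 * t * (1 - ‖z‖ ^ 2) / ε ^ 2 * ‖g z‖ ^ 2 := by
    intro z hz
    have hpos := norm_pos_iff.2 (sub_ne_zero_of_norm_eq_one ha hz)
    have h1 : ‖h z‖ ≤ 1 := by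
      rw [hnorm]
      exact div_le_one_of_le₀ (norm_sub_le_norm_sub ha hε.le hz) (norm_nonneg _)
    have h2 : ‖h z‖ ^ 2 ≤ ‖a - z‖ ^ 2 / ε ^ 2 := by
      rw [hnorm, div_pow]
      gcongr
      exact le_norm_sub ha hε.le hz
    have h3 := one_sub_norm_atomicInner_sq_le t ha z
    have hp : 0 ≤ 2 * t * ((1 - ‖z‖ ^ 2) / ‖a - z‖ ^ 2) :=
      mul_nonneg (by positivity) (div_nonneg (one_sub_norm_sq_pos hz).le (by positivity))
    have h4 : ‖h z‖ ^ 2 * (1 - ‖atomicInner t a z‖ ^ 2) ≤ 2 * t * (1 - ‖z‖ ^ 2) / ε ^ 2 := by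
      calc ‖h z‖ ^ 2 * (1 - ‖atomicInner t a z‖ ^ 2)
          ≤ ‖h z‖ ^ 2 * (2 * t * ((1 - ‖z‖ ^ 2) / ‖a - z‖ ^ 2)) := by gcongr
        _ ≤ ‖a - z‖ ^ 2 / ε ^ 2 * (2 * t * ((1 - ‖z‖ ^ 2) / ‖a - z‖ ^ 2)) := by gcongr
        _ = 2 * t * (1 - ‖z‖ ^ 2) / ε ^ 2 := by field_simp
    have h5 : ‖h z‖ ^ 2 ≤ 1 := pow_le_one₀ (norm_nonneg _) h1
    rw [hfg z hz, norm_mul, norm_mul, mul_pow, mul_pow, ← add_mul]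
    gcongr
    have := mul_le_of_le_one_left (sq_nonneg ‖atomicInner t a z‖) h5
    linarith
  -- On the circle of radius `R` the error carries the constant factor `1 - R ^ 2`, which vanishes
  -- as `R → 1` with `ε` fixed.
  have hR : ∀ R ∈ Ioo r 1, Real.circleAverage (fun z => ‖h z * g z‖ ^ 2) 0 r ≤
      ‖f‖ ^ 2 + 2 * t * (1 - R ^ 2) / ε ^ 2 * ‖g‖ ^ 2 := by
    intro R hR
    have hRI : R ∈ Ico (0 : ℝ) 1 := ⟨hr.1.trans hR.1.le, hR.2⟩
    have hm := mean_mono (hd.mul g.isHardy.holo) hr.1 hR.1.le hR.2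
    have hif := circleIntegrable f.isHardy.holo hRI
    have hig := circleIntegrable g.isHardy.holo hRI
    have hsq : ∀ F : H2, Real.circleAverage (fun z => ‖F z‖ ^ 2) 0 R ≤ ‖F‖ ^ 2 := fun F =>
      (mean_le_iff _ _ (norm_nonneg _)).1 (F.mean_le_norm hRI)
    have hc : 0 ≤ 2 * t * (1 - R ^ 2) / ε ^ 2 :=
      div_nonneg (mul_nonneg (by positivity) (by nlinarith [hRI.1, hRI.2])) (by positivity)
    calc Real.circleAverage (fun z => ‖h z * g z‖ ^ 2) 0 r
        ≤ mean (fun z => h z * g z) R ^ 2 := (mean_le_iff _ _ (mean_nonneg _ _)).1 hm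
      _ = Real.circleAverage (fun z => ‖h z * g z‖ ^ 2) 0 R := Real.sq_sqrt (avg_nonneg _ _)
      _ ≤ Real.circleAverage ((fun z => ‖f z‖ ^ 2) +
            (2 * t * (1 - R ^ 2) / ε ^ 2) • fun z => ‖g z‖ ^ 2) 0 R := by
          apply Real.circleAverage_mono (circleIntegrable (hd.mul g.isHardy.holo) hRI)
            (hif.add hig.const_smul)
          intro z hz
          have hzR : ‖z‖ = R := by simpa [abs_of_nonneg hRI.1] using hz
          have := hpt z (sphere_subset hRI hz)
          rwa [hzR] at this
      _ = Real.circleAverage (fun z => ‖f z‖ ^ 2) 0 R +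
            2 * t * (1 - R ^ 2) / ε ^ 2 * Real.circleAverage (fun z => ‖g z‖ ^ 2) 0 R := by
          rw [Real.circleAverage_add hif hig.const_smul, Real.circleAverage_smul, smul_eq_mul]
      _ ≤ ‖f‖ ^ 2 + 2 * t * (1 - R ^ 2) / ε ^ 2 * ‖g‖ ^ 2 := by
          gcongr
          · exact hsq f
          · exact hsq g
  rw [mean_le_iff _ _ (norm_nonneg _)]
  have hlim : Tendsto (fun R : ℝ => ‖f‖ ^ 2 + 2 * t * (1 - R ^ 2) / ε ^ 2 * ‖g‖ ^ 2) (𝓝[<] 1)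
      (𝓝 (‖f‖ ^ 2)) := by
    have hcont : Continuous fun R : ℝ => ‖f‖ ^ 2 + 2 * t * (1 - R ^ 2) / ε ^ 2 * ‖g‖ ^ 2 := by
      fun_prop
    have := (hcont.tendsto 1).mono_left (nhdsWithin_le_nhds (s := Iio 1))
    simpa using this
  apply ge_of_tendsto hlim
  filter_upwards [Ioo_mem_nhdsLT hr.2] with R hRr
  exact hR R hRr

/-- Let `ε → 0` in `mean_damped_le` on a fixed circle, where the damping factor tends to one
uniformly. -/
theorem norm_le_of_eq_atomicInner_mul {t : ℝ} (ht : 0 ≤ t) {a : ℂ} (ha : ‖a‖ = 1) {f g : H2}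
    (hfg : ∀ z ∈ ball (0 : ℂ) 1, f z = atomicInner t a z * g z) : ‖g‖ ≤ ‖f‖ := by
  refine g.norm_le_of fun r hr => ?_
  -- On `‖z‖ = r` one has `|a - z| ≥ 1 - r`, so the inverse of the damping factor is at most `1 + ε
  -- K` in modulus.
  set K : ℝ := 1 / (1 - r) with hK
  have hr1 : 0 < 1 - r := by linarith [hr.2]
  have hbound : ∀ ε > 0, mean g r ≤ (1 + ε * K) * ‖f‖ := by
    intro ε hε
    have hcK : ‖((1 + ε * K : ℝ) : ℂ)‖ = 1 + ε * K := by
      rw [Complex.norm_real, Real.norm_of_nonneg (by positivity)]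
    have hd : DifferentiableOn ℂ (fun z => (a - z) / ((1 + ε : ℝ) * a - z) * g z) (ball 0 1) := by
      apply DifferentiableOn.mul _ g.isHardy.holo
      apply DifferentiableOn.div
      · fun_prop
      · fun_prop
      · exact fun z hz => sub_ne_zero_of_lt ha hε.le hz
    calc mean g r
        ≤ mean (((1 + ε * K : ℝ) : ℂ) • fun z => (a - z) / ((1 + ε : ℝ) * a - z) * g z) r := by
          apply mean_le_mean_of_norm_le g.isHardy.holo (hd.const_smul _) hr
          intro z hz
          have hzr : ‖z‖ = r := by simpa using hz
          have hzb : z ∈ ball (0 : ℂ) 1 := by simpa [hzr] using hr.2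
          have hne := norm_pos_iff.2 (sub_ne_zero_of_lt ha hε.le hzb)
          have h1 : 1 - r ≤ ‖a - z‖ := by
            have := norm_sub_norm_le a z
            rwa [ha, hzr] at this
          have h2 : ‖(1 + ε : ℝ) * a - z‖ ≤ ‖a - z‖ + ε := by
            have : (1 + ε : ℝ) * a - z = (a - z) + (ε : ℂ) * a := by push_cast; ring
            rw [this]
            refine (norm_add_le _ _).trans_eq ?_
            rw [norm_mul, ha, mul_one, Complex.norm_real, Real.norm_of_nonneg hε.le]
          have h3 : 1 ≤ K * ‖a - z‖ := by
            rw [hK, div_mul_eq_mul_div, one_mul, one_le_div hr1]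
            exact h1
          rw [Pi.smul_apply, norm_smul, hcK, norm_mul, norm_div, ← mul_assoc]
          refine le_mul_of_one_le_left (norm_nonneg _) ?_
          rw [← mul_div_assoc, one_le_div hne]
          nlinarith
      _ ≤ (1 + ε * K) * ‖f‖ := by
          rw [mean_smul, hcK]
          gcongr
          exact mean_damped_le ht ha hfg hε hr
  have hlim : Tendsto (fun ε : ℝ => (1 + ε * K) * ‖f‖) (𝓝[>] 0) (𝓝 ‖f‖) := by
    have hcont : Continuous fun ε : ℝ => (1 + ε * K) * ‖f‖ := by fun_prop
    have := (hcont.tendsto 0).mono_left (nhdsWithin_le_nhds (s := Ioi 0))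
    simpa using this
  exact ge_of_tendsto hlim (eventually_nhdsWithin_of_forall hbound)

theorem differentiableOn_div_atomicInner (t : ℝ) {a : ℂ} (ha : ‖a‖ = 1) (f : H2) :
    DifferentiableOn ℂ (fun z => f z / atomicInner t a z) (ball 0 1) :=
  f.isHardy.holo.div (differentiableOn_atomicInner t ha) fun _ _ => atomicInner_ne_zero _ _ _

/-- The bound `‖f‖` is explicit, so membership becomes one inequality for each radius, and each of
these survives limits in `H²`. -/
theorem mem_mulRange_atomicInner_iff {t : ℝ} (ht : 0 ≤ t) {a : ℂ} (ha : ‖a‖ = 1) (f : H2) :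
    f ∈ mulRange (atomicInner t a) ↔
      ∀ r ∈ Ico (0 : ℝ) 1, mean (fun z => f z / atomicInner t a z) r ≤ ‖f‖ := by
  constructor
  · rintro ⟨g, hg⟩ r hr
    have h : ∀ z ∈ ball (0 : ℂ) 1, f z / atomicInner t a z = g z := fun z hz => by
      rw [hg z hz, mul_div_cancel_left₀ _ (atomicInner_ne_zero t a z)]
    rw [mean_congr hr h]
    exact (g.mean_le_norm hr).trans (norm_le_of_eq_atomicInner_mul ht ha hg)
  · intro h
    exact ⟨H2.mk _ (isHardy_indicator (differentiableOn_div_atomicInner t ha f) h), fun z hz => by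
      rw [H2.mk_fn, indicator_of_mem hz, mul_div_cancel₀ _ (atomicInner_ne_zero t a z)]⟩

theorem exists_mean_div_atomicInner_le (t : ℝ) {a : ℂ} (ha : ‖a‖ = 1) {r : ℝ}
    (hr : r ∈ Ico (0 : ℝ) 1) :
    ∃ M, ∀ f : H2, mean (fun z => f z / atomicInner t a z) r ≤ M * ‖f‖ := by
  obtain ⟨M, hM⟩ := (isCompact_sphere (0 : ℂ) r).exists_bound_of_continuousOn
    (f := fun z => (atomicInner t a z)⁻¹)
    (((differentiableOn_atomicInner t ha).continuousOn.mono fun z hz =>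
      sphere_subset hr (by rwa [abs_of_nonneg hr.1])).inv₀ fun _ _ => atomicInner_ne_zero _ _ _)
  have hM0 : 0 ≤ M := (norm_nonneg _).trans (hM r (by simp [abs_of_nonneg hr.1]))
  have hMn : ‖(M : ℂ)‖ = M := by rw [Complex.norm_real, Real.norm_of_nonneg hM0]
  refine ⟨M, fun f => ?_⟩
  calc mean (fun z => f z / atomicInner t a z) r ≤ mean ((M : ℂ) • H2.fn f) r := by
        apply mean_le_mean_of_norm_le (differentiableOn_div_atomicInner t ha f)
          (f.isHardy.holo.const_smul _) hr
        intro z hz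
        rw [Pi.smul_apply, norm_smul, hMn, div_eq_inv_mul, norm_mul]
        exact mul_le_mul_of_nonneg_right (hM z hz) (norm_nonneg _)
    _ ≤ M * ‖f‖ := by
        rw [mean_smul, hMn]
        exact mul_le_mul_of_nonneg_left (f.mean_le_norm hr) hM0

theorem isClosed_mulRange_atomicInner {t : ℝ} (ht : 0 ≤ t) {a : ℂ} (ha : ‖a‖ = 1) :
    IsClosed (mulRange (atomicInner t a) : Set H2) := by
  refine isSeqClosed_iff_isClosed.1 fun F f hF hlim => ?_
  rw [SetLike.mem_coe, mem_mulRange_atomicInner_iff ht ha]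
  intro r hr
  -- `M` depends on `r`, which is harmless: `r` is fixed while `n → ∞`.
  obtain ⟨M, hM⟩ := exists_mean_div_atomicInner_le t ha hr
  have hle : ∀ n, mean (fun z => f z / atomicInner t a z) r ≤ ‖F n‖ + M * ‖f - F n‖ := by
    intro n
    have hsplit : (fun z => f z / atomicInner t a z) =
        (fun z => F n z / atomicInner t a z) + fun z => (f - F n) z / atomicInner t a z := by
      funext z
      rw [Pi.add_apply, sub_fn, Pi.sub_apply, ← add_div, add_sub_cancel]
    rw [hsplit]
    exact (mean_add_le (differentiableOn_div_atomicInner t ha _)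
      (differentiableOn_div_atomicInner t ha _) hr).trans
      (add_le_add ((mem_mulRange_atomicInner_iff ht ha _).1 (hF n) r hr) (hM _))
  have htend : Tendsto (fun n => ‖F n‖ + M * ‖f - F n‖) atTop (𝓝 ‖f‖) := by
    have := hlim.norm.add ((hlim.const_sub f).norm.const_mul M)
    simpa using this
  exact ge_of_tendsto' htend hle

theorem compOp_mem_mulRange_atomicInner {φ : ℂ → ℂ} (hφ : IsHolSelfMap φ) {a : ℂ} (ha : ‖a‖ = 1)
    (hJ : ∀ z ∈ ball (0 : ℂ) 1,
      (1 - ‖z‖ ^ 2) / ‖a - z‖ ^ 2 ≤ (1 - ‖φ z‖ ^ 2) / ‖a - φ z‖ ^ 2)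
    {t : ℝ} (ht : 0 ≤ t) {f : H2} (hf : f ∈ mulRange (atomicInner t a)) :
    compOp φ hφ f ∈ mulRange (atomicInner t a) := by
  obtain ⟨g, hg⟩ := hf
  have hd : DifferentiableOn ℂ (fun z => atomicInner t a (φ z) / atomicInner t a z) (ball 0 1) :=
    ((differentiableOn_atomicInner t ha).comp hφ.holo hφ.mapsTo).div
      (differentiableOn_atomicInner t ha) fun _ _ => atomicInner_ne_zero _ _ _
  have h1 : ∀ z ∈ ball (0 : ℂ) 1, ‖atomicInner t a (φ z) / atomicInner t a z‖ ≤ 1 := by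
    intro z hz
    rw [norm_div]
    apply div_le_one_of_le₀ _ (norm_nonneg _)
    rw [norm_atomicInner t ha, norm_atomicInner t ha]
    exact Real.exp_le_exp.2 (neg_le_neg (mul_le_mul_of_nonneg_left (hJ z hz) ht))
  refine ⟨contractiveMul _ hd h1 (compOp φ hφ g), fun z hz => ?_⟩
  rw [contractiveMul_apply hd h1 _ hz, compOp_apply hφ f hz, compOp_apply hφ g hz,
    hg _ (hφ.mapsTo hz), ← mul_assoc, mul_div_cancel₀ _ (atomicInner_ne_zero t a z)]

theorem mulRange_atomicInner_mem_lat {φ : ℂ → ℂ} (hφ : IsHolSelfMap φ) {a : ℂ} (ha : ‖a‖ = 1)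
    (hJ : ∀ z ∈ ball (0 : ℂ) 1,
      (1 - ‖z‖ ^ 2) / ‖a - z‖ ^ 2 ≤ (1 - ‖φ z‖ ^ 2) / ‖a - φ z‖ ^ 2)
    {t : ℝ} (ht : 0 < t) :
    mulRange (atomicInner t a) ≠ ⊥ ∧ mulRange (atomicInner t a) ≠ ⊤ ∧
      mulRange (atomicInner t a) ∈ Lat (compOp φ hφ) ∩ Lat shiftOp := by
  have h0 : (0 : ℂ) ∈ ball (0 : ℂ) 1 := mem_ball_self one_pos
  have hcl := isClosed_mulRange_atomicInner ht.le ha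
  refine ⟨fun hbot => ?_, fun htop => ?_,
    ⟨hcl, fun f hf => compOp_mem_mulRange_atomicInner hφ ha hJ ht.le hf⟩,
    hcl, fun f hf => shiftOp_mem_mulRange hf⟩
  · have hd := differentiableOn_atomicInner t ha
    have h1 : ∀ z ∈ ball (0 : ℂ) 1, ‖atomicInner t a z‖ ≤ 1 := fun z hz =>
      norm_atomicInner_le_one ht.le ha hz
    have hval := contractiveMul_apply hd h1 one h0
    have hmem : contractiveMul _ hd h1 one ∈ mulRange (atomicInner t a) :=
      ⟨one, fun z hz => contractiveMul_apply hd h1 one hz⟩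
    rw [hbot, Submodule.mem_bot] at hmem
    rw [hmem, one_apply h0, mul_one] at hval
    exact atomicInner_ne_zero t a 0 hval.symm
  -- If `1 = θ g`, then `|g 0| ≤ ‖g‖ ≤ ‖1‖ ≤ 1`, whereas `|θ 0| = exp (-t) < 1`.
  · obtain ⟨g, hg⟩ : one ∈ mulRange (atomicInner t a) := htop ▸ Submodule.mem_top
    have hle := (norm_apply_zero_le g).trans
      ((norm_le_of_eq_atomicInner_mul ht.le ha hg).trans norm_one_le)
    have hval := congrArg norm (hg 0 h0)
    have hlt : ‖atomicInner t a 0‖ < 1 := by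
      rw [norm_atomicInner t ha, Real.exp_lt_one_iff]
      simpa [ha] using ht
    rw [one_apply h0, norm_one, norm_mul] at hval
    nlinarith [norm_nonneg (atomicInner t a 0)]

end Hardy

theorem theorem3p2 (φ : ℂ → ℂ) (hφ : Hardy.IsHolSelfMap φ) :
    (∃ S : Submodule ℂ Hardy.H2, S ≠ ⊥ ∧ S ≠ ⊤ ∧
      S ∈ Hardy.Lat (Hardy.compOp φ hφ) ∩ Hardy.Lat Hardy.shiftOp) ∧
    (∀ α ∈ Metric.ball (0 : ℂ) 1, φ α = α →
      Hardy.mulRange (Hardy.blaschkeFactor α) ≠ ⊥ ∧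
      Hardy.mulRange (Hardy.blaschkeFactor α) ≠ ⊤ ∧
      Hardy.mulRange (Hardy.blaschkeFactor α) ∈
        Hardy.Lat (Hardy.compOp φ hφ) ∩ Hardy.Lat Hardy.shiftOp) ∧
    ((∀ z ∈ Metric.ball (0 : ℂ) 1, φ z ≠ z) →
      ∃ a : ℂ, ‖a‖ = 1 ∧ Hardy.IsDenjoyWolffPoint φ a ∧
        ∀ t : ℝ, 0 < t →
          Hardy.mulRange (Hardy.atomicInner t a) ≠ ⊥ ∧
          Hardy.mulRange (Hardy.atomicInner t a) ≠ ⊤ ∧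
          Hardy.mulRange (Hardy.atomicInner t a) ∈
            Hardy.Lat (Hardy.compOp φ hφ) ∩ Hardy.Lat Hardy.shiftOp) := by
  refine ⟨?_, fun α hα hfix => Hardy.mulRange_blaschkeFactor_mem_lat hφ hα hfix, fun hfix => ?_⟩
  · by_cases h : ∃ α ∈ Metric.ball (0 : ℂ) 1, φ α = α
    · obtain ⟨α, hα, hfix⟩ := h
      exact ⟨_, Hardy.mulRange_blaschkeFactor_mem_lat hφ hα hfix⟩
    · push Not at h
      obtain ⟨a, ha, hJ⟩ := Hardy.exists_julia_point hφ h
      exact ⟨_, Hardy.mulRange_atomicInner_mem_lat hφ ha hJ one_pos⟩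
  · obtain ⟨a, ha, hJ⟩ := Hardy.exists_julia_point hφ hfix
    exact ⟨a, ha, Hardy.isDenjoyWolffPoint_of_julia hφ hfix ha hJ, fun t ht =>
      Hardy.mulRange_atomicInner_mem_lat hφ ha hJ ht⟩
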